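/- Let $\Omega$ be the category of finite, non-empty, non-planar rooted trees. Its arrows $S\to T$ are the maps $\Omega(S)\to\Omega(T)$ of coloured symmetric operads in sets, where $\Omega(T)$ is the operad freely generated by the vertices of $T$, with the edges of $T$ as colours. Let $dSet$ be the category of presheaves of sets on $\Omega$ (dendroidal sets), and let $\Omega[T]$ be the presheaf represented by $T$. Let $i:\Delta\to\Omega$ be the inclusion of the simplex category, which sends $[n]$ to the linear tree with $n$ vertices and $n+1$ edges. Let $i^*:dSet\to sSet$ be the restriction along $i$ and let $i_!:sSet\to dSet$ be its left adjoint, the left Kan extension along $i$. For an operad $P$ let $N_d(P)$ be its dendroidal nerve, $N_d(P)_T=\mathrm{Hom}_{Operad}(\Omega(T),P)$. Let $\otimes_{BV}$ be the Boardman–Vogt tensor product of operads. The tensor product $\otimes: dSet\times dSet\to dSet$ is the functor that preserves colimits in each variable and satisfies $\Omega[S]\otimes\Omega[T]=N_d(\Omega(S)\otimes_{BV}\Omega(T))$, that is $$(X\otimes Y)_R=\int^{S,T\in\Omega}X_S\times Y_T\times N_d(\Omega(S)\otimes_{BV}\Omega(T))_R .$$ The corresponding internal Hom is $\underline{Hom}(X,Y)_T=\mathrm{Hom}_{dSet}(\Omega[T]\otimes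 X,Y)$. **Proposition.** For simplicial sets $X$ and $Y$ and a dendroidal set $D$ there are isomorphisms 1. $i_!(X\times Y)\cong i_!(X)\otimes i_!(Y)$, natural in $X$ and $Y$; 2. $i^*\underline{Hom}(i_!(X),D)\cong (i^*D)^X$, natural in $X$ and $D$; 3. $i^*\underline{Hom}(i_!(X),i_!(Y))\cong Y^X$, natural in $X$ and $Y$. Here $X\times Y$ is the product of simplicial sets, and $K^X$ is the exponential (internal Hom) in the cartesian closed category $sSet$. -/

import Mathlib

open CategoryTheory

universe u v w

namespace Dendroidal

/-! ### Finite sequences and their concatenations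

A sequence `c₁, …, cₙ` is a function on `Fin n`.  The bijection `finSigmaFinEquiv` of Mathlib is
the lexicographic numbering of the positions in a concatenation of sequences. -/

/-- The concatenation `a₀, a₁, …, aₙ₋₁` of the sequences `aᵢ`, where `aᵢ` has length `k i`. -/
abbrev concat {C : Type u} {n : ℕ} {k : Fin n → ℕ} (a : ∀ i, Fin (k i) → C) :
    Fin (∑ i, k i) → C :=
  fun x => a (finSigmaFinEquiv.symm x).1 (finSigmaFinEquiv.symm x).2

/-- A bijection between double indices `(i, j)`, seen as a bijection between the positions in
two concatenations. -/
def positions {n m : ℕ} {k : Fin n → ℕ} {l : Fin m → ℕ}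
    (e : (Σ i, Fin (k i)) ≃ Σ j, Fin (l j)) : Fin (∑ i, k i) ≃ Fin (∑ j, l j) :=
  finSigmaFinEquiv.symm.trans (e.trans finSigmaFinEquiv)

theorem concat_positions {C : Type u} {n m : ℕ} {k : Fin n → ℕ} {l : Fin m → ℕ}
    {a : ∀ i, Fin (k i) → C} {b : ∀ j, Fin (l j) → C}
    (e : (Σ i, Fin (k i)) ≃ Σ j, Fin (l j)) (h : ∀ x, a x.1 x.2 = b (e x).1 (e x).2)
    (x : Fin (∑ i, k i)) : concat a x = concat b (positions e x) := by
  have H : finSigmaFinEquiv.symm (positions e x) = e (finSigmaFinEquiv.symm x) := by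
    simp [positions]
  exact (h _).trans (congrArg (fun y : (Σ j, Fin (l j)) => b y.1 y.2) H.symm)

/-- The concatenation of one sequence of length `k` has `k` positions. -/
def positionsOne (k : ℕ) : Fin (∑ _ : Fin 1, k) ≃ Fin k :=
  finSigmaFinEquiv.symm.trans ((Equiv.sigmaEquivProd (Fin 1) (Fin k)).trans
    (Equiv.uniqueProd (Fin k) (Fin 1)))

/-- The concatenation of `n` sequences of length one has `n` positions. -/
def positionsOnes (n : ℕ) : Fin (∑ _ : Fin n, 1) ≃ Fin n :=
  finSigmaFinEquiv.symm.trans ((Equiv.sigmaEquivProd (Fin n) (Fin 1)).trans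
    (Equiv.prodUnique (Fin n) (Fin 1)))

/-- The two ways of numbering the positions in a twofold concatenation. -/
def positionsAssoc {n : ℕ} {k : Fin n → ℕ} (l : ∀ i, Fin (k i) → ℕ) :
    Fin (∑ x : Fin (∑ i, k i), concat l x) ≃ Fin (∑ i, ∑ j, l i j) :=
  finSigmaFinEquiv.symm.trans
    ((Equiv.sigmaCongrLeft (β := fun y : (Σ i, Fin (k i)) => Fin (l y.1 y.2))
      finSigmaFinEquiv.symm).trans
    ((Equiv.sigmaAssoc fun i j => Fin (l i j)).trans
    ((Equiv.sigmaCongrRight fun _ => finSigmaFinEquiv).trans finSigmaFinEquiv)))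

theorem concat_positionsOne {C : Type u} {k : ℕ} (a : Fin k → C) (x : Fin (∑ _ : Fin 1, k)) :
    concat (fun _ : Fin 1 => a) x = a (positionsOne k x) := by
  simp [concat, positionsOne]

theorem concat_positionsOnes {C : Type u} {n : ℕ} (c : Fin n → C) (x : Fin (∑ _ : Fin n, 1)) :
    concat (fun (i : Fin n) (_ : Fin 1) => c i) x = c (positionsOnes n x) := by
  simp [concat, positionsOnes]

theorem concat_positionsAssoc {C : Type u} {n : ℕ} {k : Fin n → ℕ} {l : ∀ i, Fin (k i) → ℕ}
    (a : ∀ i j, Fin (l i j) → C) (x : Fin (∑ x : Fin (∑ i, k i), concat l x)) :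
    concat (k := concat l) (fun x => a (finSigmaFinEquiv.symm x).1 (finSigmaFinEquiv.symm x).2) x
      = concat (fun i => concat (a i)) (positionsAssoc l x) := by
  let y := finSigmaFinEquiv.symm (finSigmaFinEquiv.symm x).1
  let z : Fin (l y.1 y.2) := (finSigmaFinEquiv.symm x).2
  have H : finSigmaFinEquiv.symm (positionsAssoc l x) = ⟨y.1, finSigmaFinEquiv ⟨y.2, z⟩⟩ :=
    Equiv.symm_apply_apply _ _
  have H' : concat (a y.1) (finSigmaFinEquiv ⟨y.2, z⟩) = a y.1 y.2 z :=
    congrArg (fun t : (Σ j, Fin (l y.1 j)) => a y.1 t.1 t.2) (Equiv.symm_apply_apply _ _)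
  exact H'.symm.trans (congrArg
    (fun t : (Σ i, Fin (∑ j, l i j)) => concat (a t.1) t.2) H.symm)

/-! ### Coloured symmetric operads in sets -/

/-- A (small, coloured, symmetric) operad in sets.  `Op c c₀` is the set
`P(c₁, …, cₙ; c₀)`, where `c` is the sequence `c₁, …, cₙ`.  The right actions of the symmetric
groups are given by `act`: for a bijection `e` and `p ∈ P(c₁, …, cₙ; c₀)` the operation
`act e _ p` lies in `P(c_{e 1}, …, c_{e m}; c₀)`.  (Such an `e : Fin m ≃ Fin n` exists only if
`m = n`; writing `m` and `n`, and naming the target sequence `b`, avoids transports along equalities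
of natural numbers and of sequences.) -/
structure Operad : Type (u + 1) where
  /-- the set of colours -/
  Colour : Type u
  /-- the sets of operations -/
  Op : {n : ℕ} → (Fin n → Colour) → Colour → Type u
  /-- the units `1_c` -/
  one : (c : Colour) → Op (fun _ : Fin 1 => c) c
  /-- the composition `p(q₁, …, qₙ)` -/
  comp : {n : ℕ} → {k : Fin n → ℕ} → {c : Fin n → Colour} → {a : ∀ i, Fin (k i) → Colour} →
    {c₀ : Colour} → Op c c₀ → (∀ i, Op (a i) (c i)) → Op (concat a) c₀
  /-- the actions of the symmetric groups -/
  act : {n m : ℕ} → {c : Fin n → Colour} → {b : Fin m → Colour} → {c₀ : Colour} →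
    (e : Fin m ≃ Fin n) → (∀ x, b x = c (e x)) → Op c c₀ → Op b c₀
  act_refl : ∀ {n : ℕ} {c : Fin n → Colour} {c₀ : Colour} (p : Op c c₀),
    act (Equiv.refl _) (fun _ => rfl) p = p
  act_act : ∀ {n m l : ℕ} {c : Fin n → Colour} {b : Fin m → Colour} {a : Fin l → Colour}
    {c₀ : Colour} (e : Fin m ≃ Fin n) (h : ∀ x, b x = c (e x)) (e' : Fin l ≃ Fin m)
    (h' : ∀ x, a x = b (e' x)) (p : Op c c₀),
    act e' h' (act e h p) = act (e'.trans e) (fun x => (h' x).trans (h (e' x))) p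
  one_comp : ∀ {k : ℕ} {a : Fin k → Colour} {c₀ : Colour} (q : Op a c₀),
    comp (one c₀) (fun _ => q) = act (positionsOne k) (concat_positionsOne a) q
  comp_one : ∀ {n : ℕ} {c : Fin n → Colour} {c₀ : Colour} (p : Op c c₀),
    comp p (fun i => one (c i)) = act (positionsOnes n) (concat_positionsOnes c) p
  assoc : ∀ {n : ℕ} {k : Fin n → ℕ} {l : ∀ i, Fin (k i) → ℕ} {c : Fin n → Colour}
    {b : ∀ i, Fin (k i) → Colour} {a : ∀ i j, Fin (l i j) → Colour} {c₀ : Colour}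
    (p : Op c c₀) (q : ∀ i, Op (b i) (c i)) (r : ∀ i j, Op (a i j) (b i j)),
    comp (k := concat l) (comp p q)
        (fun x => r (finSigmaFinEquiv.symm x).1 (finSigmaFinEquiv.symm x).2) =
      act (positionsAssoc l) (concat_positionsAssoc a) (comp p (fun i => comp (q i) (r i)))
  /-- equivariance of the composition in its first argument -/
  act_comp : ∀ {n m : ℕ} {k : Fin n → ℕ} {c : Fin n → Colour} {a : ∀ i, Fin (k i) → Colour}
    {c₀ : Colour} (e : Fin m ≃ Fin n) (p : Op c c₀) (q : ∀ i, Op (a i) (c i)),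
    comp (act (b := fun j => c (e j)) e (fun _ => rfl) p) (fun j => q (e j)) =
      act (positions (Equiv.sigmaCongrLeft (β := fun i => Fin (k i)) e))
        (concat_positions _ fun _ => rfl) (comp p q)
  /-- equivariance of the composition in its other arguments -/
  comp_act : ∀ {n : ℕ} {k l : Fin n → ℕ} {c : Fin n → Colour} {a : ∀ i, Fin (k i) → Colour}
    {b : ∀ i, Fin (l i) → Colour} {c₀ : Colour} (e : ∀ i, Fin (l i) ≃ Fin (k i))
    (h : ∀ i x, b i x = a i (e i x)) (p : Op c c₀) (q : ∀ i, Op (a i) (c i)),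
    comp p (fun i => act (e i) (h i) (q i)) =
      act (positions (Equiv.sigmaCongrRight e)) (concat_positions _ fun x => h x.1 x.2) (comp p q)

namespace Operad

/-- A map of operads. -/
structure Map (P : Operad.{u}) (Q : Operad.{v}) : Type (max u v) where
  /-- the map on colours -/
  colour : P.Colour → Q.Colour
  /-- the maps on operations -/
  op : {n : ℕ} → {c : Fin n → P.Colour} → {c₀ : P.Colour} →
    P.Op c c₀ → Q.Op (fun i => colour (c i)) (colour c₀)
  op_one : ∀ c, op (P.one c) = Q.one (colour c)
  op_comp : ∀ {n : ℕ} {k : Fin n → ℕ} {c : Fin n → P.Colour} {a : ∀ i, Fin (k i) → P.Colour}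
    {c₀ : P.Colour} (p : P.Op c c₀) (q : ∀ i, P.Op (a i) (c i)),
    op (P.comp p q) = Q.comp (op p) (fun i => op (q i))
  op_act : ∀ {n m : ℕ} {c : Fin n → P.Colour} {b : Fin m → P.Colour} {c₀ : P.Colour}
    (e : Fin m ≃ Fin n) (h : ∀ x, b x = c (e x)) (p : P.Op c c₀),
    op (P.act e h p) = Q.act e (fun x => congrArg colour (h x)) (op p)

/-- The identity map. -/
def Map.id (P : Operad.{u}) : Map P P where
  colour c := c
  op p := p
  op_one _ := rfl
  op_comp _ _ := rfl
  op_act _ _ _ := rfl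

/-- The composite of two maps, in diagrammatic order. -/
def Map.comp {P : Operad.{u}} {Q : Operad.{v}} {R : Operad.{w}} (f : Map P Q)
    (g : Map Q R) : Map P R where
  colour c := g.colour (f.colour c)
  op p := g.op (f.op p)
  op_one c := by rw [f.op_one, g.op_one]
  op_comp p q := by rw [f.op_comp, g.op_comp]
  op_act e h p := by rw [f.op_act, g.op_act]

/-- The category of (small) operads. -/
instance : Category.{u} Operad.{u} where
  Hom := Map
  id := Map.id
  comp := Map.comp

end Operad

/-! ### Trees -/

/-- A finite, non-empty, non-planar tree with a designated root, given by its edges.  A vertex is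
recorded by its outgoing edge: `top e` says that there is a vertex at the upper end of `e`, whose
outgoing edge is `e`.  An edge `e ≠ root` is an input of exactly one vertex, and `below e` is the
outgoing edge of that vertex; `below root = root` is a convention.  The last axiom says that every
edge is connected to the root.  A leaf is an edge `e` without a vertex on top, and a vertex without
inputs (a vertex of valence `0`) is an edge `e` with `top e` that is not `below` any other edge.
For the category of trees to be small, the edges are numbered `0, …, numEdges - 1`. -/
structure Tree : Type where
  /-- the number of edges -/
  numEdges : ℕ
  /-- the root edge -/
  root : Fin numEdges
  /-- `top e` says that `e` is the outgoing edge of a vertex -/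
  top : Fin numEdges → Prop
  /-- the outgoing edge of the vertex of which the given edge is an input -/
  below : Fin numEdges → Fin numEdges
  below_root : below root = root
  top_below : ∀ e, e ≠ root → top (below e)
  exists_iterate : ∀ e, ∃ k : ℕ, below^[k] e = root

namespace Tree

/-- The edges of a tree. -/
abbrev Edge (T : Tree) : Type := Fin T.numEdges

/-- The sequence `c` lists the input edges of the vertex with outgoing edge `e`, each of them
once. -/
structure IsVertex (T : Tree) {n : ℕ} (c : Fin n → T.Edge) (e : T.Edge) : Prop where
  top : T.top e
  injective : Function.Injective c
  mem_range_iff : ∀ x, x ∈ Set.range c ↔ x ≠ T.root ∧ T.below x = e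

/-- `T.Generated c e` says that the operad generated by the vertices of `T` has an operation with
inputs `c₁, …, cₙ` and output `e`: the operations are the units, the vertices (in any planar
representation), and what is obtained from them by compositions and permutations. -/
inductive Generated (T : Tree) : {n : ℕ} → (Fin n → T.Edge) → T.Edge → Prop
  | one (e : T.Edge) : Generated T (fun _ : Fin 1 => e) e
  | vertex {n : ℕ} (c : Fin n → T.Edge) (e : T.Edge) (h : T.IsVertex c e) : Generated T c e
  | comp {n : ℕ} {k : Fin n → ℕ} {c : Fin n → T.Edge} {a : ∀ i, Fin (k i) → T.Edge} {e : T.Edge} :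
      Generated T c e → (∀ i, Generated T (a i) (c i)) → Generated T (concat a) e
  | act {n m : ℕ} {c : Fin n → T.Edge} {b : Fin m → T.Edge} {e : T.Edge} (s : Fin m ≃ Fin n)
      (h : ∀ x, b x = c (s x)) : Generated T c e → Generated T b e

/-- The operad `Ω(T)` generated by the tree `T`: its colours are the edges, its operations are
generated by the vertices, and each set of operations has at most one element. -/
def operad (T : Tree) : Operad.{0} where
  Colour := T.Edge
  Op c e := PLift (T.Generated c e)
  one e := ⟨.one e⟩
  comp p q := ⟨.comp p.down fun i => (q i).down⟩
  act e h p := ⟨.act e h p.down⟩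
  act_refl _ := rfl
  act_act _ _ _ _ _ := rfl
  one_comp _ := rfl
  comp_one _ := rfl
  assoc _ _ _ := rfl
  act_comp _ _ _ := rfl
  comp_act _ _ _ _ := rfl

/-- The category `Ω`: its objects are trees, and its arrows `S ⟶ T` are the maps of operads
`Ω(S) ⟶ Ω(T)`. -/
instance : SmallCategory Tree where
  Hom S T := S.operad ⟶ T.operad
  id T := 𝟙 T.operad
  comp f g := f ≫ g

/-- The functor `T ↦ Ω(T)` from trees to operads; it is the identity on arrows. -/
def toOperad : Tree ⥤ Operad.{0} where
  obj := operad
  map f := f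

/-- A function on edges that sends the vertices of `S` to operations of `Ω(T)` defines a map
`S ⟶ T`. -/
def mkHom {S T : Tree} (f : S.Edge → T.Edge)
    (h : ∀ {n : ℕ} (c : Fin n → S.Edge) (e : S.Edge), S.IsVertex c e →
      T.Generated (fun i => f (c i)) (f e)) : S ⟶ T :=
  let g : ∀ {n : ℕ} {c : Fin n → S.Edge} {e : S.Edge}, S.Generated c e →
      T.Generated (fun i => f (c i)) (f e) := fun p => by
    induction p with
    | one e => exact .one _
    | vertex c e hv => exact h c e hv
    | comp _ _ ih ih' => exact .comp ih ih'
    | act s hs _ ih => exact .act s (fun x => congrArg f (hs x)) ih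
  show Operad.Map S.operad T.operad from
  { colour := f
    op := fun p => ⟨g p.down⟩
    op_one := fun _ => rfl
    op_comp := fun _ _ => rfl
    op_act := fun _ _ _ => rfl }

theorem hom_ext {S T : Tree} {f g : S ⟶ T}
    (h : Operad.Map.colour f = Operad.Map.colour g) : f = g := by
  change Operad.Map S.operad T.operad at f g
  obtain ⟨f, f', _, _, _⟩ := f
  obtain ⟨g, g', _, _, _⟩ := g
  obtain rfl : f = g := h
  have : @f' = @g' := by
    funext n c e p
    exact congrArg PLift.up (rfl : (f' p).down = (g' p).down)
  subst this
  rfl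

/-- The linear tree `[n]` with edges `0, 1, …, n` from top to bottom and with `n` unary vertices,
the `i`-th of which has input `i - 1` and output `i`. -/
def linear (n : ℕ) : Tree where
  numEdges := n + 1
  root := Fin.last n
  top e := e ≠ 0
  below e := ⟨min (e + 1) n, by omega⟩
  below_root := by ext; simp
  top_below e he := by
    have h : (e : ℕ) ≠ n := fun h => he (Fin.ext h)
    intro h0
    have := congrArg Fin.val h0
    simp at this
    omega
  exists_iterate e := by
    refine ⟨n, ?_⟩
    have key : ∀ (k : ℕ) (x : Fin (n + 1)),
        (((fun e : Fin (n + 1) => (⟨min ((e : ℕ) + 1) n, by omega⟩ : Fin (n + 1)))^[k] x : Fin (n + 1)) : ℕ)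
          = min ((x : ℕ) + k) n := by
      intro k
      induction k with
      | zero => intro x; simp; omega
      | succ k ih => intro x; rw [Function.iterate_succ_apply, ih]; simp; omega
    ext
    rw [key]
    simp

theorem linear_generated {n : ℕ} : ∀ (k : ℕ) (a b : (linear n).Edge), (b : ℕ) = (a : ℕ) + k →
    (linear n).Generated (fun _ : Fin 1 => a) b := by
  intro k
  induction k with
  | zero =>
    intro a b h
    obtain rfl : a = b := Fin.ext (by omega)
    exact .one a
  | succ k ih =>
    intro a b h
    have hb : (b : ℕ) < n + 1 := b.isLt
    let a' : (linear n).Edge := (⟨a + k, by omega⟩ : Fin (n + 1))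
    have hv : (linear n).IsVertex (fun _ : Fin 1 => a') b := by
      refine ⟨fun h0 => ?_, fun _ _ _ => Subsingleton.elim _ _, fun x => ?_⟩
      · have : (b : ℕ) = 0 := congrArg Fin.val h0
        omega
      · have hx : (x : ℕ) < n + 1 := x.isLt
        have e1 : x ≠ (linear n).root ↔ (x : ℕ) ≠ n := not_congr Fin.ext_iff
        have e2 : (linear n).below x = b ↔ min ((x : ℕ) + 1) n = (b : ℕ) := Fin.ext_iff
        have e3 : a' = x ↔ (a : ℕ) + k = (x : ℕ) := Fin.ext_iff
        simp only [Set.mem_range, exists_const, e1, e2, e3]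
        omega
    have := Generated.comp (.vertex _ _ hv) (fun _ => ih a a' rfl)
    refine .act (positionsOne 1).symm (fun x => rfl) this

/-- The inclusion `i : Δ ⥤ Ω`. -/
def inclusion : SimplexCategory ⥤ Tree where
  obj n := linear n.len
  map {m n} f := mkHom (S := linear m.len) (T := linear n.len)
    (fun x => f.toOrderHom x) fun {k} c e hv => by
      have hsub : ∀ i, (c i : ℕ) + 1 = (e : ℕ) := fun i => by
        have h := (hv.mem_range_iff (c i)).1 ⟨i, rfl⟩
        have h1 : (c i : ℕ) ≠ m.len := fun h' => h.1 (Fin.ext h')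
        have h2 : min ((c i : ℕ) + 1) m.len = (e : ℕ) := congrArg Fin.val h.2
        have h3 : (c i : ℕ) < m.len + 1 := (c i).isLt
        omega
      have h0 : (e : ℕ) ≠ 0 := fun h' => hv.top (Fin.ext h')
      have hlt : (e : ℕ) < m.len + 1 := e.isLt
      let d : (linear m.len).Edge := (⟨(e : ℕ) - 1, by omega⟩ : Fin (m.len + 1))
      obtain ⟨i₀, hi₀⟩ : d ∈ Set.range c := (hv.mem_range_iff d).2 <| by
        refine ⟨fun h' => ?_, Fin.ext ?_⟩
        · have : (e : ℕ) - 1 = m.len := congrArg Fin.val h'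
          omega
        · change min ((e : ℕ) - 1 + 1) m.len = (e : ℕ)
          omega
      have hu : ∀ i, i = i₀ := fun i => hv.injective (Fin.ext (by have := hsub i; have := hsub i₀; omega))
      let s : Fin k ≃ Fin 1 :=
        ⟨fun _ => 0, fun _ => i₀, fun i => (hu i).symm, fun _ => Subsingleton.elim _ _⟩
      have hle : f.toOrderHom d ≤ f.toOrderHom e :=
        f.toOrderHom.monotone (Fin.mk_le_of_le_val (Nat.sub_le _ _))
      obtain ⟨r, hr⟩ := Nat.exists_eq_add_of_le (Fin.le_def.1 hle)
      exact .act s (fun x => by rw [hu x, hi₀]) (linear_generated r _ _ hr)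
  map_id _ := hom_ext rfl
  map_comp _ _ := hom_ext rfl

end Tree

/-! ### The Boardman–Vogt tensor product of operads -/

namespace BV

variable (P Q : Operad.{u})

/-- Formal operations of `P ⊗ Q`: the expressions built from the generators `p ⊗ d` and `c ⊗ q` by
units, compositions and permutations. -/
inductive Term : {n : ℕ} → (Fin n → P.Colour × Q.Colour) → P.Colour × Q.Colour → Type u
  | left {n : ℕ} {c : Fin n → P.Colour} {c₀ : P.Colour} (p : P.Op c c₀) (d : Q.Colour) :
      Term (fun i => (c i, d)) (c₀, d)
  | right {m : ℕ} {d : Fin m → Q.Colour} {d₀ : Q.Colour} (c : P.Colour) (q : Q.Op d d₀) :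
      Term (fun j => (c, d j)) (c, d₀)
  | one (x : P.Colour × Q.Colour) : Term (fun _ : Fin 1 => x) x
  | comp {n : ℕ} {k : Fin n → ℕ} {b : Fin n → P.Colour × Q.Colour}
      {a : ∀ i, Fin (k i) → P.Colour × Q.Colour} {x : P.Colour × Q.Colour} :
      Term b x → (∀ i, Term (a i) (b i)) → Term (concat a) x
  | act {n m : ℕ} {b : Fin n → P.Colour × Q.Colour} {a : Fin m → P.Colour × Q.Colour}
      {x : P.Colour × Q.Colour} (e : Fin m ≃ Fin n) (h : ∀ y, a y = b (e y)) :
      Term b x → Term a x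

/-- The bijection `(i, j) ↦ (j, i)` between the positions in `n` blocks of length `m` and in `m`
blocks of length `n`. -/
def interchange (n m : ℕ) : Fin (∑ _ : Fin n, m) ≃ Fin (∑ _ : Fin m, n) :=
  positions ((Equiv.sigmaEquivProd (Fin n) (Fin m)).trans
    ((Equiv.prodComm (Fin n) (Fin m)).trans (Equiv.sigmaEquivProd (Fin m) (Fin n)).symm))

/-- The equivalence relation on the formal operations of `P ⊗ Q`.  It is generated, as a congruence,
by the axioms of an operad, by the requirement that `p ↦ p ⊗ d` and `q ↦ c ⊗ q` are maps of
operads, and by the interchange relation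
`(p ⊗ d)(c₁ ⊗ q, …, cₙ ⊗ q) = (c ⊗ q)(p ⊗ d₁, …, p ⊗ dₘ)` (up to the permutation that
identifies the sequences of inputs). -/
inductive Rel : {n : ℕ} → {b : Fin n → P.Colour × Q.Colour} → {x : P.Colour × Q.Colour} →
    Term P Q b x → Term P Q b x → Prop
  -- it is an equivalence relation and a congruence
  | refl {n : ℕ} {b : Fin n → P.Colour × Q.Colour} {x : P.Colour × Q.Colour}
      (t : Term P Q b x) : Rel t t
  | symm {n : ℕ} {b : Fin n → P.Colour × Q.Colour} {x : P.Colour × Q.Colour}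
      {s t : Term P Q b x} : Rel s t → Rel t s
  | trans {n : ℕ} {b : Fin n → P.Colour × Q.Colour} {x : P.Colour × Q.Colour}
      {r s t : Term P Q b x} : Rel r s → Rel s t → Rel r t
  | congr_comp {n : ℕ} {k : Fin n → ℕ} {b : Fin n → P.Colour × Q.Colour}
      {a : ∀ i, Fin (k i) → P.Colour × Q.Colour} {x : P.Colour × Q.Colour}
      {s s' : Term P Q b x} {t t' : ∀ i, Term P Q (a i) (b i)} :
      Rel s s' → (∀ i, Rel (t i) (t' i)) → Rel (.comp s t) (.comp s' t')
  | congr_act {n m : ℕ} {b : Fin n → P.Colour × Q.Colour} {a : Fin m → P.Colour × Q.Colour}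
      {x : P.Colour × Q.Colour} (e : Fin m ≃ Fin n) (h : ∀ y, a y = b (e y))
      {s t : Term P Q b x} : Rel s t → Rel (.act e h s) (.act e h t)
  -- the axioms of an operad
  | act_refl {n : ℕ} {b : Fin n → P.Colour × Q.Colour} {x : P.Colour × Q.Colour}
      (t : Term P Q b x) : Rel (.act (Equiv.refl _) (fun _ => rfl) t) t
  | act_act {n m l : ℕ} {c : Fin n → P.Colour × Q.Colour} {b : Fin m → P.Colour × Q.Colour}
      {a : Fin l → P.Colour × Q.Colour} {x : P.Colour × Q.Colour} (e : Fin m ≃ Fin n)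
      (h : ∀ y, b y = c (e y)) (e' : Fin l ≃ Fin m) (h' : ∀ y, a y = b (e' y))
      (t : Term P Q c x) :
      Rel (.act e' h' (.act e h t)) (.act (e'.trans e) (fun y => (h' y).trans (h (e' y))) t)
  | one_comp {k : ℕ} {a : Fin k → P.Colour × Q.Colour} {x : P.Colour × Q.Colour}
      (t : Term P Q a x) :
      Rel (.comp (.one x) (fun _ => t)) (.act (positionsOne k) (concat_positionsOne a) t)
  | comp_one {n : ℕ} {b : Fin n → P.Colour × Q.Colour} {x : P.Colour × Q.Colour}
      (t : Term P Q b x) :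
      Rel (.comp t (fun i => .one (b i))) (.act (positionsOnes n) (concat_positionsOnes b) t)
  | assoc {n : ℕ} {k : Fin n → ℕ} {l : ∀ i, Fin (k i) → ℕ} {c : Fin n → P.Colour × Q.Colour}
      {b : ∀ i, Fin (k i) → P.Colour × Q.Colour} {a : ∀ i j, Fin (l i j) → P.Colour × Q.Colour}
      {x : P.Colour × Q.Colour} (r : Term P Q c x) (s : ∀ i, Term P Q (b i) (c i))
      (t : ∀ i j, Term P Q (a i j) (b i j)) :
      Rel (.comp (k := concat l) (.comp r s)
          (fun y => t (finSigmaFinEquiv.symm y).1 (finSigmaFinEquiv.symm y).2))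
        (.act (positionsAssoc l) (concat_positionsAssoc a)
          (.comp r (fun i => .comp (s i) (t i))))
  | act_comp {n m : ℕ} {k : Fin n → ℕ} {c : Fin n → P.Colour × Q.Colour}
      {a : ∀ i, Fin (k i) → P.Colour × Q.Colour} {x : P.Colour × Q.Colour} (e : Fin m ≃ Fin n)
      (s : Term P Q c x) (t : ∀ i, Term P Q (a i) (c i)) :
      Rel (.comp (.act (a := fun j => c (e j)) e (fun _ => rfl) s) (fun j => t (e j)))
        (.act (positions (Equiv.sigmaCongrLeft (β := fun i => Fin (k i)) e))
          (concat_positions _ fun _ => rfl) (.comp s t))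
  | comp_act {n : ℕ} {k l : Fin n → ℕ} {c : Fin n → P.Colour × Q.Colour}
      {a : ∀ i, Fin (k i) → P.Colour × Q.Colour} {b : ∀ i, Fin (l i) → P.Colour × Q.Colour}
      {x : P.Colour × Q.Colour} (e : ∀ i, Fin (l i) ≃ Fin (k i))
      (h : ∀ i y, b i y = a i (e i y)) (s : Term P Q c x) (t : ∀ i, Term P Q (a i) (c i)) :
      Rel (.comp s (fun i => .act (e i) (h i) (t i)))
        (.act (positions (Equiv.sigmaCongrRight e)) (concat_positions _ fun y => h y.1 y.2)
          (.comp s t))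
  -- `p ↦ p ⊗ d` is a map of operads
  | left_one (c : P.Colour) (d : Q.Colour) : Rel (.left (P.one c) d) (.one (c, d))
  | left_comp {n : ℕ} {k : Fin n → ℕ} {c : Fin n → P.Colour} {a : ∀ i, Fin (k i) → P.Colour}
      {c₀ : P.Colour} (p : P.Op c c₀) (p' : ∀ i, P.Op (a i) (c i)) (d : Q.Colour) :
      Rel (.left (P.comp p p') d) (.comp (.left p d) (fun i => .left (p' i) d))
  | left_act {n m : ℕ} {c : Fin n → P.Colour} {a : Fin m → P.Colour} {c₀ : P.Colour}
      (e : Fin m ≃ Fin n) (h : ∀ y, a y = c (e y)) (p : P.Op c c₀) (d : Q.Colour) :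
      Rel (.left (P.act e h p) d)
        (.act e (fun y => congrArg (fun z => (z, d)) (h y)) (.left p d))
  -- `q ↦ c ⊗ q` is a map of operads
  | right_one (c : P.Colour) (d : Q.Colour) : Rel (.right c (Q.one d)) (.one (c, d))
  | right_comp {m : ℕ} {k : Fin m → ℕ} {d : Fin m → Q.Colour} {a : ∀ i, Fin (k i) → Q.Colour}
      {d₀ : Q.Colour} (c : P.Colour) (q : Q.Op d d₀) (q' : ∀ i, Q.Op (a i) (d i)) :
      Rel (.right c (Q.comp q q')) (.comp (.right c q) (fun i => .right c (q' i)))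
  | right_act {n m : ℕ} {d : Fin n → Q.Colour} {a : Fin m → Q.Colour} {d₀ : Q.Colour}
      (c : P.Colour) (e : Fin m ≃ Fin n) (h : ∀ y, a y = d (e y)) (q : Q.Op d d₀) :
      Rel (.right c (Q.act e h q))
        (.act e (fun y => congrArg (fun z => (c, z)) (h y)) (.right c q))
  -- the interchange relation
  | interchange {n m : ℕ} {c : Fin n → P.Colour} {c₀ : P.Colour} {d : Fin m → Q.Colour}
      {d₀ : Q.Colour} (p : P.Op c c₀) (q : Q.Op d d₀) :
      Rel (.comp (.left p d₀) (fun i => .right (c i) q))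
        (.act (interchange n m)
          (concat_positions (a := fun i j => (c i, d j)) (b := fun j i => (c i, d j)) _
            fun _ => rfl)
          (.comp (.right c₀ q) (fun j => .left p (d j))))

/-- The equivalence relation as a setoid. -/
instance termSetoid {n : ℕ} (b : Fin n → P.Colour × Q.Colour) (x : P.Colour × Q.Colour) :
    Setoid (Term P Q b x) where
  r := Rel P Q
  iseqv := ⟨.refl, .symm, .trans⟩

variable {P Q}

/-- The class of a formal operation. -/
def mk {n : ℕ} {b : Fin n → P.Colour × Q.Colour} {x : P.Colour × Q.Colour} (t : Term P Q b x) :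
    Quotient (termSetoid P Q b x) := Quotient.mk _ t

theorem sound {n : ℕ} {b : Fin n → P.Colour × Q.Colour} {x : P.Colour × Q.Colour}
    {s t : Term P Q b x} (h : Rel P Q s t) : mk s = mk t := Quotient.sound h

theorem exists_rep {n : ℕ} {b : Fin n → P.Colour × Q.Colour} {x : P.Colour × Q.Colour}
    (z : Quotient (termSetoid P Q b x)) : ∃ t, mk t = z := Quotient.exists_rep z

/-- The composition of classes, computed on representatives. -/
noncomputable def compClass {n : ℕ} {k : Fin n → ℕ} {b : Fin n → P.Colour × Q.Colour}
    {a : ∀ i, Fin (k i) → P.Colour × Q.Colour} {x : P.Colour × Q.Colour}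
    (s : Quotient (termSetoid P Q b x)) (t : ∀ i, Quotient (termSetoid P Q (a i) (b i))) :
    Quotient (termSetoid P Q (concat a) x) :=
  mk (.comp s.out fun i => (t i).out)

theorem compClass_mk {n : ℕ} {k : Fin n → ℕ} {b : Fin n → P.Colour × Q.Colour}
    {a : ∀ i, Fin (k i) → P.Colour × Q.Colour} {x : P.Colour × Q.Colour}
    (s : Term P Q b x) (t : ∀ i, Term P Q (a i) (b i)) :
    compClass (mk s) (fun i => mk (t i)) = mk (.comp s t) :=
  sound (.congr_comp (Quotient.mk_out s) fun i => Quotient.mk_out (t i))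

/-- The action of a bijection on classes. -/
def actClass {n m : ℕ} {b : Fin n → P.Colour × Q.Colour} {a : Fin m → P.Colour × Q.Colour}
    {x : P.Colour × Q.Colour} (e : Fin m ≃ Fin n) (h : ∀ y, a y = b (e y)) :
    Quotient (termSetoid P Q b x) → Quotient (termSetoid P Q a x) :=
  Quotient.map (.act e h) fun _ _ r => .congr_act e h r

theorem actClass_mk {n m : ℕ} {b : Fin n → P.Colour × Q.Colour} {a : Fin m → P.Colour × Q.Colour}
    {x : P.Colour × Q.Colour} (e : Fin m ≃ Fin n) (h : ∀ y, a y = b (e y)) (t : Term P Q b x) :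
    actClass e h (mk t) = mk (.act e h t) := rfl

/-- The Boardman–Vogt tensor product `P ⊗ Q`. -/
noncomputable def tensor (P Q : Operad.{u}) : Operad.{u} where
  Colour := P.Colour × Q.Colour
  Op b x := Quotient (termSetoid P Q b x)
  one x := mk (.one x)
  comp s t := compClass s t
  act e h t := actClass e h t
  act_refl t := by
    obtain ⟨t, rfl⟩ := exists_rep t
    exact sound (.act_refl t)
  act_act e h e' h' t := by
    obtain ⟨t, rfl⟩ := exists_rep t
    exact sound (.act_act e h e' h' t)
  one_comp t := by
    obtain ⟨t, rfl⟩ := exists_rep t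
    exact (compClass_mk _ _).trans (sound (.one_comp t))
  comp_one t := by
    obtain ⟨t, rfl⟩ := exists_rep t
    exact (compClass_mk _ _).trans (sound (.comp_one t))
  assoc r s t := by
    obtain ⟨r, rfl⟩ := exists_rep r
    choose s hs using fun i => exists_rep (s i)
    choose t ht using fun i j => exists_rep (t i j)
    obtain rfl := funext hs
    obtain rfl := funext fun i => funext (ht i)
    have h : ∀ i, compClass (mk (s i)) (fun j => mk (t i j)) = mk (.comp (s i) (t i)) :=
      fun i => compClass_mk _ _
    simp only [h]
    rw [compClass_mk r s, compClass_mk r fun i => .comp (s i) (t i), actClass_mk,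
      ← sound (.assoc r s t)]
    exact compClass_mk _ _
  act_comp e s t := by
    obtain ⟨s, rfl⟩ := exists_rep s
    choose t ht using fun i => exists_rep (t i)
    obtain rfl := funext ht
    rw [compClass_mk, actClass_mk, actClass_mk, ← sound (.act_comp e s t)]
    exact compClass_mk _ _
  comp_act e h s t := by
    obtain ⟨s, rfl⟩ := exists_rep s
    choose t ht using fun i => exists_rep (t i)
    obtain rfl := funext ht
    rw [compClass_mk, actClass_mk, ← sound (.comp_act e h s t)]
    exact compClass_mk _ _

/-- The effect of two maps of operads on formal operations. -/
def Term.map {P P' Q Q' : Operad.{u}} (f : P.Map P') (g : Q.Map Q') {n : ℕ}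
    {b : Fin n → P.Colour × Q.Colour} {x : P.Colour × Q.Colour} (t : Term P Q b x) :
    Term P' Q' (fun i => (f.colour (b i).1, g.colour (b i).2)) (f.colour x.1, g.colour x.2) :=
  match t with
  | .left p d => .left (f.op p) (g.colour d)
  | .right c q => .right (f.colour c) (g.op q)
  | .one _ => .one _
  | .comp s t => .comp (s.map f g) (fun i => (t i).map f g)
  | .act e h t => .act e (fun y => by rw [h y]) (t.map f g)

theorem Rel.map {P P' Q Q' : Operad.{u}} (f : P.Map P') (g : Q.Map Q') {n : ℕ}
    {b : Fin n → P.Colour × Q.Colour} {x : P.Colour × Q.Colour} {s t : Term P Q b x}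
    (r : Rel P Q s t) : Rel P' Q' (s.map f g) (t.map f g) := by
  induction r with
  | refl t => exact .refl _
  | symm _ ih => exact .symm ih
  | trans _ _ ih ih' => exact .trans ih ih'
  | congr_comp _ _ ih ih' => exact .congr_comp ih ih'
  | congr_act e h _ ih => exact .congr_act e _ ih
  | act_refl t => exact .act_refl _
  | act_act e h e' h' t => exact .act_act e _ e' _ _
  | one_comp t => exact .one_comp _
  | comp_one t => exact .comp_one _
  | assoc r s t => exact .assoc _ _ (fun i j => (t i j).map f g)
  | act_comp e s t => exact .act_comp e _ (fun i => (t i).map f g)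
  | comp_act e h s t => exact .comp_act e _ _ (fun i => (t i).map f g)
  | left_one c d =>
    have := Rel.left_one (P := P') (Q := Q') (f.colour c) (g.colour d)
    rw [← f.op_one] at this
    exact this
  | left_comp p p' d =>
    have := Rel.left_comp (Q := Q') (f.op p) (fun i => f.op (p' i)) (g.colour d)
    rw [← f.op_comp] at this
    exact this
  | left_act e h p d =>
    have := Rel.left_act (Q := Q') e (fun y => congrArg f.colour (h y)) (f.op p) (g.colour d)
    rw [← f.op_act] at this
    exact this
  | right_one c d =>
    have := Rel.right_one (P := P') (Q := Q') (f.colour c) (g.colour d)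
    rw [← g.op_one] at this
    exact this
  | right_comp c q q' =>
    have := Rel.right_comp (P := P') (f.colour c) (g.op q) (fun i => g.op (q' i))
    rw [← g.op_comp] at this
    exact this
  | right_act c e h q =>
    have := Rel.right_act (P := P') (f.colour c) e (fun y => congrArg g.colour (h y)) (g.op q)
    rw [← g.op_act] at this
    exact this
  | interchange p q => exact .interchange (f.op p) (g.op q)

/-- The effect of two maps of operads on operations. -/
def mapClass {P P' Q Q' : Operad.{u}} (f : P.Map P') (g : Q.Map Q') {n : ℕ}
    {b : Fin n → P.Colour × Q.Colour} {x : P.Colour × Q.Colour} :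
    Quotient (termSetoid P Q b x) → Quotient (termSetoid P' Q'
      (fun i => (f.colour (b i).1, g.colour (b i).2)) (f.colour x.1, g.colour x.2)) :=
  Quotient.map (Term.map f g) fun _ _ (r : Rel P Q _ _) => r.map f g

/-- The functoriality of the Boardman–Vogt tensor product. -/
noncomputable def map {P P' Q Q' : Operad.{u}} (f : P.Map P') (g : Q.Map Q') :
    (tensor P Q).Map (tensor P' Q') where
  colour x := (f.colour x.1, g.colour x.2)
  op t := mapClass f g t
  op_one _ := rfl
  op_comp s t := by
    obtain ⟨s, rfl⟩ := exists_rep s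
    choose t ht using fun i => exists_rep (t i)
    obtain rfl := funext ht
    exact (congrArg (mapClass f g) (compClass_mk s t)).trans
      (compClass_mk (s.map f g) fun i => (t i).map f g).symm
  op_act e h t := by
    obtain ⟨t, rfl⟩ := exists_rep t
    rfl

theorem Term.map_id {n : ℕ} {b : Fin n → P.Colour × Q.Colour} {x : P.Colour × Q.Colour}
    (t : Term P Q b x) : t.map (.id P) (.id Q) = t := by
  induction t with
  | left p d => rfl
  | right c q => rfl
  | one x => rfl
  | comp s t ih ih' => exact congrArg₂ Term.comp ih (funext ih')
  | act e h t ih => exact congrArg (Term.act e h) ih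

theorem Term.map_comp {P P' P'' Q Q' Q'' : Operad.{u}} (f : P.Map P') (f' : P'.Map P'')
    (g : Q.Map Q') (g' : Q'.Map Q'') {n : ℕ} {b : Fin n → P.Colour × Q.Colour}
    {x : P.Colour × Q.Colour} (t : Term P Q b x) :
    t.map (f.comp f') (g.comp g') = (t.map f g).map f' g' := by
  induction t with
  | left p d => rfl
  | right c q => rfl
  | one x => rfl
  | comp s t ih ih' => exact congrArg₂ Term.comp ih (funext ih')
  | act e h t ih => exact congrArg (Term.act e _) ih

theorem map_id (P Q : Operad.{u}) : map (.id P) (.id Q) = .id (tensor P Q) := by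
  have : @(map (.id P) (.id Q)).op = @(Operad.Map.id (tensor P Q)).op := by
    funext n b x t
    obtain ⟨t, rfl⟩ := exists_rep t
    exact congrArg mk t.map_id
  unfold map Operad.Map.id at *
  congr

theorem map_comp {P P' P'' Q Q' Q'' : Operad.{u}} (f : P.Map P') (f' : P'.Map P'')
    (g : Q.Map Q') (g' : Q'.Map Q'') :
    map (f.comp f') (g.comp g') = (map f g).comp (map f' g') := by
  have : @(map (f.comp f') (g.comp g')).op = @((map f g).comp (map f' g')).op := by
    funext n b x t
    obtain ⟨t, rfl⟩ := exists_rep t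
    exact congrArg mk (t.map_comp f f' g g')
  unfold map Operad.Map.comp at *
  congr

end BV

/-! ### Dendroidal sets -/

/-- The Boardman–Vogt tensor product as a functor in both variables. -/
noncomputable def BV.tensorFunctor : Operad.{u} × Operad.{u} ⥤ Operad.{u} where
  obj p := BV.tensor p.1 p.2
  map f := BV.map f.1 f.2
  map_id p := BV.map_id p.1 p.2
  map_comp f g := BV.map_comp f.1 g.1 f.2 g.2

/-- A dendroidal set is a presheaf of sets on the category of trees. -/
abbrev DSet : Type (u + 1) := Treeᵒᵖ ⥤ Type u

namespace DSet

/-- The representable dendroidal set `Ω[T]`, with `Ω[T]_S = Ω(S, T)`, as a functor of `T`. -/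
abbrev representable : Tree ⥤ DSet.{u} := uliftYoneda.{u}

/-- The dendroidal nerve `N_d(P)`, with `N_d(P)_T = Hom(Ω(T), P)`. -/
def nerve : Operad.{u} ⥤ DSet.{u} where
  obj P :=
    { obj := fun T => Operad.Map T.unop.operad P
      map := fun α => ↾fun φ => Operad.Map.comp α.unop φ
      map_id := fun _ => rfl
      map_comp := fun _ _ => rfl }
  map f := { app := fun _ => ↾fun φ => Operad.Map.comp φ f
             naturality := fun _ _ _ => rfl }
  map_id _ := rfl
  map_comp _ _ := rfl

/-- The functor `(S, T) ↦ N_d(Ω(S) ⊗ Ω(T))`, where `⊗` is the Boardman–Vogt tensor product. -/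
noncomputable def bv : Tree × Tree ⥤ DSet.{0} :=
  Tree.toOperad.prod Tree.toOperad ⋙ BV.tensorFunctor ⋙ nerve

/-- The elements of `∐_{S, T} X_S × Y_T × N_d(Ω(S) ⊗ Ω(T))_R`. -/
structure PreTensor (X Y : DSet.{u}) (R : Treeᵒᵖ) : Type u where
  /-- the first tree -/
  S : Tree
  /-- the second tree -/
  T : Tree
  /-- the dendrex of `X` -/
  x : X.obj (.op S)
  /-- the dendrex of `Y` -/
  y : Y.obj (.op T)
  /-- the dendrex of `N_d(Ω(S) ⊗ Ω(T))` -/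
  z : (bv.obj (S, T)).obj R

/-- The relation `(α^* x, β^* y, z) ∼ (x, y, (α ⊗ β)_* z)`, for arrows `α : S ⟶ S'` and
`β : T ⟶ T'` of trees. -/
inductive TensorRel (X Y : DSet.{u}) (R : Treeᵒᵖ) : PreTensor X Y R → PreTensor X Y R → Prop
  | mk {S S' T T' : Tree} (α : S ⟶ S') (β : T ⟶ T') (x : X.obj (.op S')) (y : Y.obj (.op T'))
      (z : (bv.obj (S, T)).obj R) :
      TensorRel X Y R ⟨S, T, X.map α.op x, Y.map β.op y, z⟩
        ⟨S', T', x, y, (bv.map (X := (S, T)) (Y := (S', T')) (α, β)).app R z⟩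

/-- The tensor product `X ⊗ Y` of dendroidal sets.  It is the functor that preserves colimits in
each variable and is given on representables by `Ω[S] ⊗ Ω[T] = N_d(Ω(S) ⊗ Ω(T))`, that is the left
Kan extension `∫^{S, T} X_S × Y_T × N_d(Ω(S) ⊗ Ω(T))`, written as a quotient. -/
noncomputable def tensorObj (X Y : DSet.{u}) : DSet.{u} where
  obj R := Quot (TensorRel X Y R)
  map {R R'} ρ := ↾Quot.map (fun t => ⟨t.S, t.T, t.x, t.y, (bv.obj (t.S, t.T)).map ρ t.z⟩) (by
    rintro _ _ ⟨α, β, x, y, z⟩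
    exact .mk α β x y ((bv.obj _).map ρ z))
  map_id R := by
    ext ⟨t⟩
    rfl
  map_comp ρ ρ' := by
    ext ⟨t⟩
    rfl

/-- The functoriality of the tensor product. -/
noncomputable def tensorMap {X X' Y Y' : DSet.{u}} (f : X ⟶ X') (g : Y ⟶ Y') :
    tensorObj X Y ⟶ tensorObj X' Y' where
  app R := ↾Quot.map (fun t => ⟨t.S, t.T, f.app _ t.x, g.app _ t.y, t.z⟩) (by
    rintro _ _ ⟨α, β, x, y, z⟩
    have hx := NatTrans.naturality_apply f α.op x
    have hy := NatTrans.naturality_apply g β.op y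
    dsimp only
    rw [hx, hy]
    exact .mk α β _ _ z)
  naturality R R' ρ := by
    ext ⟨t⟩
    rfl

/-- The tensor product of dendroidal sets as a functor in both variables. -/
noncomputable def tensor : DSet.{u} ⥤ DSet.{u} ⥤ DSet.{u} where
  obj X :=
    { obj := fun Y => tensorObj X Y
      map := fun g => tensorMap (𝟙 X) g
      map_id := fun Y => by
        ext R ⟨t⟩
        rfl
      map_comp := fun g g' => by
        ext R ⟨t⟩
        rfl }
  map f :=
    { app := fun Y => tensorMap f (𝟙 Y)
      naturality := fun Y Y' g => by
        ext R ⟨t⟩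
        rfl }
  map_id X := by
    ext Y R ⟨t⟩
    rfl
  map_comp f f' := by
    ext Y R ⟨t⟩
    rfl

/-- The internal Hom of dendroidal sets, with `Hom(X, Y)_T = Hom(Ω[T] ⊗ X, Y)`, as a functor in both
variables: the functor `T ↦ Ω[T] ⊗ X` is composed with the functor `Hom(-, Y)`. -/
noncomputable def internalHom : DSet.{u}ᵒᵖ ⥤ DSet.{u} ⥤ DSet.{u} :=
  (tensor.flip ⋙ (Functor.whiskeringLeft _ _ _).obj representable).op ⋙ Functor.opHom _ _ ⋙
    Functor.whiskeringLeft _ _ _ ⋙ (Functor.whiskeringLeft _ _ _).obj yoneda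

theorem internalHom_obj (X Y : DSet.{u}) (T : Treeᵒᵖ) :
    ((internalHom.obj (.op X)).obj Y).obj T =
      ((tensor.obj (representable.obj T.unop)).obj X ⟶ Y) := rfl

theorem internalHom_map {X Y : DSet.{u}} {T T' : Treeᵒᵖ} (α : T ⟶ T')
    (φ : (tensor.obj (representable.obj T.unop)).obj X ⟶ Y) :
    ((internalHom.obj (.op X)).obj Y).map α φ =
      (tensor.map (representable.map α.unop)).app X ≫ φ := rfl

theorem internalHom_functorial {X X' Y Y' : DSet.{u}} (f : X' ⟶ X) (g : Y ⟶ Y') (T : Treeᵒᵖ)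
    (φ : (tensor.obj (representable.obj T.unop)).obj X ⟶ Y) :
    (((internalHom.map f.op).app Y ≫ (internalHom.obj (.op X')).map g).app T) φ =
      ((tensor.obj (representable.obj T.unop)).map f ≫ φ) ≫ g := rfl

/-- The restriction functor `i^* : dSet ⥤ sSet`. -/
def restriction : DSet.{u} ⥤ SSet.{u} :=
  (Functor.whiskeringLeft _ _ _).obj Tree.inclusion.op

/-- The left adjoint `i_! : sSet ⥤ dSet` of `i^*`, given by left Kan extension along `i`. -/
noncomputable def extension : SSet.{u} ⥤ DSet.{u} :=
  Tree.inclusion.op.lan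

end DSet

end Dendroidal

open MonoidalCategory Dendroidal

/-!
The operad of a linear tree is unary (all its operations have one input) and thin (there is at most
one operation with given inputs and output); it is the category `[n]`.  The Boardman–Vogt tensor
product of two unary thin operads is again unary and thin (`BV.tensor_isUnary`,
`BV.tensor_isThin`): the interchange relation allows one to write every operation as
`(p ⊗ d')(c ⊗ q)`, so that the tensor product is the product of two preorders.  It therefore has
projections and diagonals, and maps into it are determined by their effect on colours.

A tree with a map to a linear tree has only unary vertices, and such a tree is isomorphic to a
linear one (`Tree.isoLinear`).  Hence `i_! X` is empty at all other trees
(`DSet.extension_isLinear`), and a map between such linear dendroidal sets is an isomorphism as soon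
as its restriction along `i` is (`DSet.IsLinear.isIso`).  For linear `A` and `B` the tensor product
is linear as well, and the diagonals give a natural map `i^* A × i^* B ⟶ i^*(A ⊗ B)`, which is
inverted by the projections (`DSet.isIso_diagonalPair`).  As `i` is fully faithful, the unit
`X ⟶ i^* i_! X` is an isomorphism.  Both facts together show that the map
`i_!(X × Y) ⟶ i_! X ⊗ i_! Y` that is adjoint to the diagonal is an isomorphism after restriction,
and so is an isomorphism.

The other two isomorphisms are formal consequences.  With `Ω[n] ≅ i_! Δ[n]`, the maps
`Ω[n] ⊗ i_! X ⟶ D` correspond to the maps `i_!(Δ[n] × X) ⟶ D`, that is to the maps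
`Δ[n] × X ⟶ i^* D`, which are the `n`-simplices of `(i^* D)^X` (`DSet.internalHomEquiv`); for
`D = i_! Y` it remains to use `i^* i_! Y ≅ Y`.
-/

namespace Dendroidal

namespace Operad

/-! ### Unary and thin operads -/

/-- An operad is unary if all its operations have exactly one input, that is, if it is (the operad
of) a category. -/
def IsUnary (P : Operad.{u}) : Prop :=
  ∀ ⦃n : ℕ⦄ ⦃c : Fin n → P.Colour⦄ ⦃c₀ : P.Colour⦄, P.Op c c₀ → n = 1

/-- An operad is thin if it has at most one operation with given inputs and output. -/
def IsThin (P : Operad.{u}) : Prop :=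
  ∀ ⦃n : ℕ⦄ ⦃c : Fin n → P.Colour⦄ ⦃c₀ : P.Colour⦄ (p q : P.Op c c₀), p = q

theorem IsUnary.of_map {P : Operad.{u}} {Q : Operad.{v}} (hQ : Q.IsUnary) (f : P.Map Q) :
    P.IsUnary :=
  fun _ _ _ p => hQ (f.op p)

/-- A map to a thin operad is determined by its effect on colours. -/
theorem IsThin.map_ext {P : Operad.{u}} {Q : Operad.{v}} (hQ : Q.IsThin) {f g : P.Map Q}
    (h : f.colour = g.colour) : f = g := by
  obtain ⟨f, f', _, _, _⟩ := f
  obtain ⟨g, g', _, _, _⟩ := g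
  obtain rfl : f = g := h
  obtain rfl : @f' = @g' := by
    funext n c e p
    exact hQ _ _
  rfl

/-- A function on colours that respects the existence of operations is a map to a thin operad. -/
noncomputable def IsThin.mkMap {P : Operad.{u}} {Q : Operad.{v}} (hQ : Q.IsThin)
    (f : P.Colour → Q.Colour)
    (h : ∀ {n : ℕ} {c : Fin n → P.Colour} {c₀ : P.Colour}, P.Op c c₀ →
      Nonempty (Q.Op (fun i => f (c i)) (f c₀))) : P.Map Q where
  colour := f
  op p := (h p).some
  op_one _ := hQ _ _
  op_comp _ _ := hQ _ _
  op_act _ _ _ := hQ _ _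

/-! ### The category of unary operations -/

/-- The set of unary operations from `a` to `b`. -/
abbrev Unary (P : Operad.{u}) (a b : P.Colour) : Type u := P.Op (fun _ : Fin 1 => a) b

instance : Subsingleton (Fin (∑ _ : Fin 1, 1)) :=
  (positionsOne 1).injective.subsingleton

/-- The composite of two unary operations, in diagrammatic order.  The permutation `positionsOne 1`
only renames the position in a concatenation of one sequence of length one. -/
def compU (P : Operad.{u}) {a b c : P.Colour} (f : P.Unary a b) (g : P.Unary b c) : P.Unary a c :=
  P.act (positionsOne 1).symm (fun _ => rfl) (P.comp g fun _ => f)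

/-- If a sequence has at most one position, then the bijection by which one acts is irrelevant. -/
theorem act_congr (P : Operad.{u}) {n m : ℕ} [Subsingleton (Fin n)] {c : Fin n → P.Colour}
    {b : Fin m → P.Colour} {c₀ : P.Colour} {e e' : Fin m ≃ Fin n} {h : ∀ x, b x = c (e x)}
    {h' : ∀ x, b x = c (e' x)} (p : P.Op c c₀) : P.act e h p = P.act e' h' p := by
  obtain rfl : e = e' := Equiv.ext fun _ => Subsingleton.elim _ _
  rfl

theorem act_eq_self (P : Operad.{u}) {n : ℕ} [Subsingleton (Fin n)] {c : Fin n → P.Colour}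
    {c₀ : P.Colour} (e : Fin n ≃ Fin n) (h : ∀ x, c x = c (e x)) (p : P.Op c c₀) :
    P.act e h p = p :=
  (P.act_congr p).trans (P.act_refl p)

theorem comp_eq_act_compU (P : Operad.{u}) {a b c : P.Colour} (f : P.Unary a b)
    (g : P.Unary b c) :
    P.comp g (fun _ => f) = P.act (positionsOne 1) (fun _ => rfl) (P.compU f g) := by
  rw [compU, act_act]
  exact (P.act_eq_self _ _ _).symm

theorem id_compU (P : Operad.{u}) {a b : P.Colour} (f : P.Unary a b) :
    P.compU (P.one a) f = f := by
  rw [compU, show P.comp f (fun _ => P.one a) = _ from P.comp_one f, act_act]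
  exact P.act_eq_self _ _ _

theorem compU_id (P : Operad.{u}) {a b : P.Colour} (f : P.Unary a b) :
    P.compU f (P.one b) = f := by
  rw [compU, P.one_comp f, act_act]
  exact P.act_eq_self _ _ _

theorem compU_assoc (P : Operad.{u}) {a b c d : P.Colour} (f : P.Unary a b) (g : P.Unary b c)
    (h : P.Unary c d) : P.compU (P.compU f g) h = P.compU f (P.compU g h) := by
  let σ : Fin 1 ≃ Fin (∑ _ : Fin 1, 1) := (positionsOne 1).symm
  have : Subsingleton (Fin (∑ _ : Fin 1, ∑ _ : Fin 1, 1)) :=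
    (positionsOne _).injective.subsingleton
  have h₁ : P.comp (k := fun _ : Fin (∑ _ : Fin 1, 1) => 1) (a := fun _ _ => a)
      (P.comp h fun _ => g) (fun _ => f) =
      P.act (positionsAssoc fun (_ : Fin 1) (_ : Fin 1) => 1) (fun _ => rfl)
        (P.comp (a := fun _ _ => a) h fun _ => P.comp (a := fun _ _ => a) g fun _ => f) :=
    P.assoc h (fun _ => g) (fun _ _ => f)
  have h₂ : P.comp (a := fun _ _ => a) h (fun _ => P.compU f g) =
      P.act (positions (Equiv.sigmaCongrRight fun _ => σ)) (fun _ => rfl)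
        (P.comp (a := fun _ _ => a) h fun _ => P.comp (a := fun _ _ => a) g fun _ => f) :=
    P.comp_act (fun _ => σ) (fun _ _ => rfl) h (fun _ => P.comp g fun _ => f)
  have h₃ : P.comp (a := fun _ _ => a) (P.compU g h) (fun _ => f) =
      P.act (positions (Equiv.sigmaCongrLeft (β := fun _ => Fin 1) σ)) (fun _ => rfl)
        (P.comp (k := fun _ : Fin (∑ _ : Fin 1, 1) => 1) (a := fun _ _ => a)
          (P.comp h fun _ => g) (fun _ => f)) :=
    P.act_comp σ (P.comp h fun _ => g) (fun _ => f)
  have h₄ : P.compU (P.compU f g) h =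
      P.act σ (fun _ => rfl) (P.comp (a := fun _ _ => a) h (fun _ => P.compU f g)) := rfl
  have h₅ : P.compU f (P.compU g h) =
      P.act σ (fun _ => rfl) (P.comp (a := fun _ _ => a) (P.compU g h) (fun _ => f)) := rfl
  rw [h₄, h₅, h₂, h₃, h₁, P.act_act, P.act_act, P.act_act]
  exact P.act_congr _

/-- Two composites `r ≫ l` can be multiplied componentwise if the middle factors commute. -/
theorem compU_compU_compU_comm (P : Operad.{u}) {a b c d e b' : P.Colour} (r : P.Unary a b)
    (l : P.Unary b c) (r' : P.Unary c d) (l' : P.Unary d e) (r'' : P.Unary b b')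
    (l'' : P.Unary b' d) (h : P.compU l r' = P.compU r'' l'') :
    P.compU (P.compU r l) (P.compU r' l') = P.compU (P.compU r r'') (P.compU l'' l') := by
  rw [P.compU_assoc, ← P.compU_assoc l, h, P.compU_assoc, P.compU_assoc]

end Operad

namespace BV

variable {P Q : Operad.{u}}

/-! ### The tensor product of unary operads -/

theorem Term.arity_eq_one (hP : P.IsUnary) (hQ : Q.IsUnary) {n : ℕ}
    {b : Fin n → P.Colour × Q.Colour} {x : P.Colour × Q.Colour} (t : Term P Q b x) : n = 1 := by
  induction t with
  | left p _ => exact hP p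
  | right _ q => exact hQ q
  | one _ => rfl
  | comp _ _ ih ih' => simp [ih, ih']
  | act e _ _ ih => exact (Fin.equiv_iff_eq.1 ⟨e⟩).trans ih

theorem tensor_isUnary (hP : P.IsUnary) (hQ : Q.IsUnary) : (tensor P Q).IsUnary := by
  intro n b x t
  obtain ⟨t, -⟩ := exists_rep t
  exact t.arity_eq_one hP hQ

/-- If `Q` is unary, then a formal operation of `P ⊗ Q` has an underlying operation of `P`: the
generators `c ⊗ q` are replaced by units. -/
theorem Term.nonempty_fst (hQ : Q.IsUnary) {n : ℕ}
    {b : Fin n → P.Colour × Q.Colour} {x : P.Colour × Q.Colour} (t : Term P Q b x) :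
    Nonempty (P.Op (fun i => (b i).1) x.1) := by
  induction t with
  | left p _ => exact ⟨p⟩
  | right c q =>
    obtain rfl := hQ q
    exact ⟨P.one c⟩
  | one x => exact ⟨P.one x.1⟩
  | comp _ _ ih ih' => exact ⟨P.comp ih.some fun i => (ih' i).some⟩
  | act e h _ ih => exact ⟨P.act e (fun y => congrArg Prod.fst (h y)) ih.some⟩

theorem Term.nonempty_snd (hP : P.IsUnary) {n : ℕ}
    {b : Fin n → P.Colour × Q.Colour} {x : P.Colour × Q.Colour} (t : Term P Q b x) :
    Nonempty (Q.Op (fun i => (b i).2) x.2) := by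
  induction t with
  | left p d =>
    obtain rfl := hP p
    exact ⟨Q.one d⟩
  | right c q => exact ⟨q⟩
  | one x => exact ⟨Q.one x.2⟩
  | comp _ _ ih ih' => exact ⟨Q.comp ih.some fun i => (ih' i).some⟩
  | act e h _ ih => exact ⟨Q.act e (fun y => congrArg Prod.snd (h y)) ih.some⟩

/-- The projection `P ⊗ Q ⟶ P` for a thin operad `P` and a unary operad `Q`. -/
noncomputable def fst (hP : P.IsThin) (hQ : Q.IsUnary) : (tensor P Q).Map P :=
  hP.mkMap Prod.fst fun t => t.out.nonempty_fst hQ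

/-- The projection `P ⊗ Q ⟶ Q` for a thin operad `Q` and a unary operad `P`. -/
noncomputable def snd (hP : P.IsUnary) (hQ : Q.IsThin) : (tensor P Q).Map Q :=
  hQ.mkMap Prod.snd fun t => t.out.nonempty_snd hP

/-- The unary operation `p ⊗ d`. -/
def leftU {c c₀ : P.Colour} (p : P.Unary c c₀) (d : Q.Colour) :
    (tensor P Q).Unary (c, d) (c₀, d) := mk (.left p d)

/-- The unary operation `c ⊗ q`. -/
def rightU (c : P.Colour) {d d₀ : Q.Colour} (q : Q.Unary d d₀) :
    (tensor P Q).Unary (c, d) (c, d₀) := mk (.right c q)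

theorem leftU_one (c : P.Colour) (d : Q.Colour) : leftU (P.one c) d = (tensor P Q).one (c, d) :=
  sound (.left_one c d)

theorem rightU_one (c : P.Colour) (d : Q.Colour) : rightU c (Q.one d) = (tensor P Q).one (c, d) :=
  sound (.right_one c d)

theorem leftU_compU {c c' c₀ : P.Colour} (p : P.Unary c c') (p' : P.Unary c' c₀) (d : Q.Colour) :
    leftU (P.compU p p') d = (tensor P Q).compU (leftU p d) (leftU p' d) := by
  refine (sound (.left_act _ _ _ d)).trans ?_
  exact congrArg (actClass (positionsOne 1).symm fun _ => rfl)
    ((sound (.left_comp p' (fun _ => p) d)).trans (compClass_mk _ fun _ => _).symm)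

theorem rightU_compU (c : P.Colour) {d d' d₀ : Q.Colour} (q : Q.Unary d d') (q' : Q.Unary d' d₀) :
    rightU c (Q.compU q q') = (tensor P Q).compU (rightU c q) (rightU c q') := by
  refine (sound (.right_act c _ _ _)).trans ?_
  exact congrArg (actClass (positionsOne 1).symm fun _ => rfl)
    ((sound (.right_comp c q' fun _ => q)).trans (compClass_mk _ fun _ => _).symm)

theorem compU_mk {x y z : P.Colour × Q.Colour} (s : Term P Q (fun _ : Fin 1 => x) y)
    (t : Term P Q (fun _ : Fin 1 => y) z) :
    (tensor P Q).compU (mk s) (mk t) =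
      mk (.act (positionsOne 1).symm (fun _ => rfl) (.comp t fun _ => s)) :=
  congrArg (actClass (positionsOne 1).symm fun _ => rfl) (compClass_mk t fun _ => s)

/-- The interchange relation for unary operations. -/
theorem compU_interchange {c c₀ : P.Colour} {d d₀ : Q.Colour} (p : P.Unary c c₀)
    (q : Q.Unary d d₀) :
    (tensor P Q).compU (rightU c q) (leftU p d₀) =
      (tensor P Q).compU (leftU p d) (rightU c₀ q) := by
  unfold leftU rightU
  rw [compU_mk, compU_mk]
  have h := congrArg (actClass (positionsOne 1).symm (a := fun _ => (c, d)) fun _ => rfl)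
    (sound (.interchange p q))
  refine h.trans ?_
  exact ((tensor P Q).act_act _ _ _ _ (mk (.comp (.right c₀ q) (fun _ => .left p d)))).trans
    ((tensor P Q).act_congr _)

/-- The unary operation `(p ⊗ d')(c ⊗ q)` of `P ⊗ Q`, for `p` from `c` to `c'` and `q` from `d` to
`d'`. -/
noncomputable def pairU {x y : P.Colour × Q.Colour} (p : P.Unary x.1 y.1) (q : Q.Unary x.2 y.2) :
    (tensor P Q).Unary x y :=
  (tensor P Q).compU (rightU x.1 q) (leftU p y.2)

theorem pairU_compU {x y z : P.Colour × Q.Colour} (p : P.Unary x.1 y.1) (q : Q.Unary x.2 y.2)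
    (p' : P.Unary y.1 z.1) (q' : Q.Unary y.2 z.2) :
    (tensor P Q).compU (pairU p q) (pairU p' q') =
      pairU (x := x) (y := z) (P.compU p p') (Q.compU q q') := by
  unfold pairU
  rw [leftU_compU, rightU_compU]
  exact Operad.compU_compU_compU_comm _ _ _ _ _ _ _ (compU_interchange p q').symm

/-- The normal form: every operation of a tensor product of thin unary operads is of the form
`pairU p q`, up to the bijection `e` that identifies its set of inputs with `Fin 1`.  Composites of
normal forms are brought into normal form by the interchange relation. -/
theorem Term.mk_eq_pairU (hP : P.IsUnary) (hP' : P.IsThin) (hQ : Q.IsUnary) (hQ' : Q.IsThin)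
    {n : ℕ} {b : Fin n → P.Colour × Q.Colour} {x : P.Colour × Q.Colour} (t : Term P Q b x)
    {y : P.Colour × Q.Colour} (e : Fin n ≃ Fin 1) (h : ∀ i, b i = y) (p : P.Unary y.1 x.1)
    (q : Q.Unary y.2 x.2) : mk t = (tensor P Q).act e h (pairU p q) := by
  induction t generalizing y with
  | @left n c c₀ p' d =>
    obtain rfl := hP p'
    obtain ⟨c, rfl⟩ : ∃ c', c = fun _ => c' := ⟨c 0, funext fun i => by rw [Subsingleton.elim i 0]⟩
    obtain rfl : (c, d) = y := h 0
    refine Eq.trans ?_ ((tensor P Q).act_eq_self _ _ _).symm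
    rw [hQ' q (Q.one d), hP' p p', pairU, rightU_one]
    exact ((tensor P Q).id_compU _).symm
  | @right n d d₀ c q' =>
    obtain rfl := hQ q'
    obtain ⟨d, rfl⟩ : ∃ d', d = fun _ => d' := ⟨d 0, funext fun i => by rw [Subsingleton.elim i 0]⟩
    obtain rfl : (c, d) = y := h 0
    refine Eq.trans ?_ ((tensor P Q).act_eq_self _ _ _).symm
    rw [hP' p (P.one c), hQ' q q', pairU, leftU_one]
    exact ((tensor P Q).compU_id _).symm
  | one x =>
    obtain rfl : x = y := h 0
    refine Eq.trans ?_ ((tensor P Q).act_eq_self _ _ _).symm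
    rw [hP' p (P.one x.1), hQ' q (Q.one x.2), pairU, leftU_one, rightU_one]
    exact ((tensor P Q).id_compU _).symm
  | @comp n k b a x s t ih ih' =>
    obtain rfl := s.arity_eq_one hP hQ
    obtain rfl : k = fun _ => 1 := funext fun i => (t i).arity_eq_one hP hQ
    obtain ⟨b, rfl⟩ : ∃ b', b = fun _ => b' := ⟨b 0, funext fun i => by rw [Subsingleton.elim i 0]⟩
    obtain ⟨a, rfl⟩ : ∃ a', a = fun _ _ => a' := ⟨a 0 0, funext fun i => funext fun j => by
      rw [Subsingleton.elim i 0, Subsingleton.elim j 0]⟩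
    obtain rfl : a = y := h (positionsOne 1 |>.symm 0)
    obtain ⟨p₁⟩ := s.nonempty_fst hQ
    obtain ⟨q₁⟩ := s.nonempty_snd hP
    obtain ⟨p₂⟩ := (t 0).nonempty_fst hQ
    obtain ⟨q₂⟩ := (t 0).nonempty_snd hP
    have h₁ := (ih (.refl _) (fun _ => rfl) p₁ q₁).trans ((tensor P Q).act_eq_self _ _ _)
    have h₂ : (fun i => mk (t i)) = fun _ => pairU (x := a) (y := b) p₂ q₂ := funext fun i =>
      (ih' i (.refl _) (fun _ => rfl) p₂ q₂).trans ((tensor P Q).act_eq_self _ _ _)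
    rw [← compClass_mk, h₁, h₂]
    refine ((tensor P Q).comp_eq_act_compU _ _).trans ?_
    rw [pairU_compU, hP' p (P.compU p₂ p₁), hQ' q (Q.compU q₂ q₁)]
    exact Operad.act_congr _ _
  | act e' h' t ih =>
    have h'' := ih (e'.symm.trans e)
      (fun i => by rw [← h (e'.symm i), h', Equiv.apply_symm_apply]) p q
    exact (congrArg (actClass e' h') h'').trans
      (((tensor P Q).act_act _ _ _ _ (pairU p q)).trans (Operad.act_congr _ _))

theorem tensor_isThin (hP : P.IsUnary) (hP' : P.IsThin) (hQ : Q.IsUnary) (hQ' : Q.IsThin) :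
    (tensor P Q).IsThin := by
  intro n b x s t
  obtain ⟨s, rfl⟩ := exists_rep s
  obtain ⟨t, rfl⟩ := exists_rep t
  obtain rfl := s.arity_eq_one hP hQ
  obtain ⟨b, rfl⟩ : ∃ b', b = fun _ => b' := ⟨b 0, funext fun i => by rw [Subsingleton.elim i 0]⟩
  obtain ⟨p⟩ := s.nonempty_fst hQ
  obtain ⟨q⟩ := s.nonempty_snd hP
  rw [s.mk_eq_pairU hP hP' hQ hQ' (.refl _) (fun _ => rfl) p q,
    t.mk_eq_pairU hP hP' hQ hQ' (.refl _) (fun _ => rfl) p q]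

/-- The diagonal `P ⟶ P ⊗ P` of a thin unary operad. -/
noncomputable def diag (hP : P.IsUnary) (hP' : P.IsThin) : P.Map (tensor P P) :=
  (tensor_isThin hP hP' hP hP').mkMap (fun c => (c, c)) fun {n c c₀} p => by
    obtain rfl := hP p
    obtain ⟨c, rfl⟩ : ∃ c', c = fun _ => c' :=
      ⟨c 0, funext fun i => by rw [Subsingleton.elim i 0]⟩
    exact ⟨pairU (x := (c, c)) (y := (c₀, c₀)) p p⟩

end BV

namespace Tree

/-! ### Linear trees -/

theorem operad_isThin (T : Tree) : T.operad.IsThin :=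
  fun _ _ _ p q => congrArg PLift.up (rfl : p.down = q.down)

theorem IsVertex.linear_succ {n k : ℕ} {c : Fin k → (linear n).Edge} {e : (linear n).Edge}
    (hv : (linear n).IsVertex c e) (i : Fin k) : (c i : ℕ) + 1 = e := by
  have h := (hv.mem_range_iff (c i)).1 ⟨i, rfl⟩
  have h₁ : (c i : ℕ) ≠ n := fun h' => h.1 (Fin.ext h')
  have h₂ : min ((c i : ℕ) + 1) n = (e : ℕ) := congrArg Fin.val h.2
  have h₃ : (c i : ℕ) < n + 1 := (c i).isLt
  omega

theorem IsVertex.linear_arity {n k : ℕ} {c : Fin k → (linear n).Edge} {e : (linear n).Edge}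
    (hv : (linear n).IsVertex c e) : k = 1 := by
  have h₀ : (e : ℕ) ≠ 0 := fun h' => hv.top (Fin.ext h')
  have hlt : (e : ℕ) < n + 1 := e.isLt
  let d : (linear n).Edge := (⟨(e : ℕ) - 1, by omega⟩ : Fin (n + 1))
  have hd : d ∈ Set.range c := (hv.mem_range_iff d).2 <| by
    refine ⟨fun h' => ?_, Fin.ext ?_⟩
    · have : (e : ℕ) - 1 = n := congrArg Fin.val h'
      omega
    · change min ((e : ℕ) - 1 + 1) n = (e : ℕ)
      omega
  obtain ⟨i₀, -⟩ := hd
  have hu : ∀ i, i = i₀ := fun i => hv.injective (Fin.ext (by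
    have := hv.linear_succ i
    have := hv.linear_succ i₀
    omega))
  have : Unique (Fin k) := ⟨⟨i₀⟩, hu⟩
  exact Fin.equiv_iff_eq.1 ⟨Equiv.ofUnique _ _⟩

theorem Generated.linear_arity {n k : ℕ} {c : Fin k → (linear n).Edge} {e : (linear n).Edge}
    (h : (linear n).Generated c e) : k = 1 := by
  induction h with
  | one _ => rfl
  | vertex _ _ hv => exact hv.linear_arity
  | comp _ _ ih ih' => simp [ih, ih']
  | act s _ _ ih => exact (Fin.equiv_iff_eq.1 ⟨s⟩).trans ih

theorem Generated.linear_le {n k : ℕ} {c : Fin k → (linear n).Edge} {e : (linear n).Edge}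
    (h : (linear n).Generated c e) (i : Fin k) : c i ≤ e := by
  induction h with
  | one _ => exact le_rfl
  | vertex _ _ hv => exact Fin.le_def.2 (hv.linear_succ i ▸ Nat.le_succ _)
  | comp _ _ ih ih' => exact (ih' _ _).trans (ih _)
  | act s hs _ ih => exact hs i ▸ ih (s i)

theorem linear_isUnary (n : ℕ) : (linear n).operad.IsUnary :=
  fun _ _ _ p => p.down.linear_arity

instance : inclusion.Faithful where
  map_injective {m n f g} h := by
    have h' : Operad.Map.colour (inclusion.map f) = Operad.Map.colour (inclusion.map g) := by
      rw [h]
    exact SimplexCategory.Hom.ext _ _ (OrderHom.ext _ _ h')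

instance : inclusion.Full where
  map_surjective {m n} f := by
    refine ⟨SimplexCategory.Hom.mk ⟨Operad.Map.colour f, fun x y hxy => ?_⟩, hom_ext rfl⟩
    obtain ⟨k, hk⟩ := Nat.exists_eq_add_of_le (Fin.le_def.1 hxy)
    exact (Operad.Map.op f ⟨linear_generated k x y hk⟩).down.linear_le 0

/-! ### Trees with only unary vertices are linear -/

section Unary

variable {T : Tree}

theorem exists_isVertex {e : T.Edge} (h : T.top e) : ∃ (n : ℕ) (c : Fin n → T.Edge),
    T.IsVertex c e := by
  classical
  let s : Finset T.Edge := {x | x ≠ T.root ∧ T.below x = e}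
  refine ⟨s.card, s.orderEmbOfFin rfl, h, (s.orderEmbOfFin rfl).injective, fun x => ?_⟩
  rw [Finset.range_orderEmbOfFin]
  simp [s]

/-- Two edges above the same unary vertex agree. -/
theorem below_injOn (hT : T.operad.IsUnary) {x y : T.Edge} (hx : x ≠ T.root) (hy : y ≠ T.root)
    (h : T.below x = T.below y) : x = y := by
  obtain ⟨n, c, hc⟩ := exists_isVertex (T.top_below x hx)
  obtain rfl := hT ⟨.vertex _ _ hc⟩
  obtain ⟨i, rfl⟩ := (hc.mem_range_iff x).2 ⟨hx, rfl⟩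
  obtain ⟨j, rfl⟩ := (hc.mem_range_iff y).2 ⟨hy, h.symm⟩
  rw [Subsingleton.elim i j]

/-- The number of vertices on the path from an edge down to the root. -/
def depth (e : T.Edge) : ℕ := Nat.find (T.exists_iterate e)

theorem depth_spec (e : T.Edge) : T.below^[depth e] e = T.root :=
  Nat.find_spec (T.exists_iterate e)

theorem eq_root_of_depth {e : T.Edge} (h : depth e = 0) : e = T.root := by
  simpa [h] using depth_spec e

theorem depth_root : depth T.root = 0 := (Nat.find_eq_zero _).2 rfl

theorem depth_eq_succ {e : T.Edge} (h : e ≠ T.root) : depth e = depth (T.below e) + 1 :=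
  Nat.find_comp_succ (T.exists_iterate e) (T.exists_iterate (T.below e)) h

theorem depth_injective (hT : T.operad.IsUnary) : Function.Injective (depth (T := T)) := by
  intro x y h
  induction hk : depth x generalizing x y with
  | zero => exact (eq_root_of_depth hk).trans (eq_root_of_depth (h.symm.trans hk)).symm
  | succ k ih =>
    have hx : x ≠ T.root := by
      rintro rfl
      rw [depth_root] at hk
      omega
    have hy : y ≠ T.root := by
      rintro rfl
      rw [depth_root] at h
      omega
    rw [depth_eq_succ hx] at h hk
    rw [depth_eq_succ hy] at h
    exact below_injOn hT hx hy (ih (by omega) (by omega))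

/-- All depths below that of a given edge occur, namely on the path from this edge to the root. -/
theorem exists_depth_eq (e : T.Edge) {k : ℕ} (hk : k ≤ depth e) : ∃ x : T.Edge, depth x = k := by
  obtain ⟨j, hj⟩ := Nat.exists_eq_add_of_le hk
  induction j generalizing e with
  | zero => exact ⟨e, hj⟩
  | succ j ih =>
    have he : e ≠ T.root := by
      rintro rfl
      rw [depth_root] at hj
      omega
    have := depth_eq_succ he
    exact ih (T.below e) (by omega) (by omega)

theorem depth_lt (e : T.Edge) : depth e < T.numEdges := by
  choose f hf using fun k : Fin (depth e + 1) => exists_depth_eq e (Nat.le_of_lt_succ k.isLt)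
  have hinj : Function.Injective f := fun k l h => Fin.ext (by rw [← hf k, ← hf l, h])
  simpa using Fintype.card_le_of_injective f hinj

/-- The edges of a tree with only unary vertices, numbered from top to bottom: the edge of depth `d`
has the number `numEdges - 1 - d`, where the root has depth `0`. -/
noncomputable def edgeEquiv (hT : T.operad.IsUnary) : T.Edge ≃ (linear (T.numEdges - 1)).Edge :=
  Equiv.ofBijective
    (fun e => (⟨T.numEdges - 1 - depth e, by omega⟩ : Fin (T.numEdges - 1 + 1))) <| by
      refine (Fintype.bijective_iff_injective_and_card (β := Fin (T.numEdges - 1 + 1)) _).2 ⟨?_, ?_⟩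
      · intro x y h
        have h' : T.numEdges - 1 - depth x = T.numEdges - 1 - depth y := congrArg Fin.val h
        have := depth_lt x
        have := depth_lt y
        exact depth_injective hT (by omega)
      · have := depth_lt T.root
        rw [Fintype.card_fin, Fintype.card_fin]
        omega

theorem depth_add_edgeEquiv (hT : T.operad.IsUnary) (e : T.Edge) :
    depth e + (edgeEquiv hT e : ℕ) + 1 = T.numEdges := by
  have := depth_lt e
  have : (edgeEquiv hT e : ℕ) = T.numEdges - 1 - depth e := rfl
  omega

/-- A tree with only unary vertices is isomorphic to a linear tree. -/
noncomputable def isoLinear (hT : T.operad.IsUnary) : T ≅ linear (T.numEdges - 1) where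
  hom := mkHom (edgeEquiv hT) fun {n} c e hv => by
    obtain rfl := hT ⟨.vertex _ _ hv⟩
    have h := (hv.mem_range_iff (c 0)).1 ⟨0, rfl⟩
    have h₁ := depth_eq_succ h.1
    rw [h.2] at h₁
    have h₂ := depth_add_edgeEquiv hT e
    have h₃ := depth_add_edgeEquiv hT (c 0)
    exact .act (.refl _) (fun x => by rw [Subsingleton.elim x 0])
      (linear_generated 1 (edgeEquiv hT (c 0)) (edgeEquiv hT e) (by omega))
  inv := mkHom (edgeEquiv hT).symm fun {n} c e hv => by
    obtain rfl := hv.linear_arity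
    have h : (c 0 : ℕ) + 1 = e := hv.linear_succ 0
    obtain ⟨x, hx⟩ := (edgeEquiv hT).surjective (c 0)
    obtain ⟨y, rfl⟩ := (edgeEquiv hT).surjective e
    rw [← hx] at h
    obtain rfl : c = fun _ => edgeEquiv hT x := funext fun i => by rw [hx, Subsingleton.elim i 0]
    simp only [Equiv.symm_apply_apply]
    have h₁ := depth_add_edgeEquiv hT x
    have h₂ := depth_add_edgeEquiv hT y
    have hx₀ : x ≠ T.root := by
      rintro rfl
      rw [depth_root] at h₁
      omega
    have hxy : T.below x = y := depth_injective hT (by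
      have := depth_eq_succ hx₀
      omega)
    refine .vertex _ _ ⟨hxy ▸ T.top_below x hx₀, fun _ _ _ => Subsingleton.elim _ _, fun z => ?_⟩
    rw [Set.range_const, Set.mem_singleton_iff]
    refine ⟨?_, fun hz => below_injOn hT hz.1 hx₀ (hz.2.trans hxy.symm)⟩
    rintro rfl
    exact ⟨hx₀, hxy⟩
  hom_inv_id := hom_ext (funext (edgeEquiv hT).symm_apply_apply)
  inv_hom_id := hom_ext (funext (edgeEquiv hT).apply_symm_apply)

end Unary

end Tree

namespace DSet

open Opposite

/-! ### Dendroidal sets that live on linear trees -/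

/-- A dendroidal set is linear if it is empty at every tree that has a vertex which is not unary,
that is, at every tree which is not isomorphic to some `i([n])`. -/
def IsLinear (A : DSet.{u}) : Prop :=
  ∀ ⦃R : Treeᵒᵖ⦄, A.obj R → R.unop.operad.IsUnary

/-- A map of linear dendroidal sets is an isomorphism if its restriction along `i` is. -/
theorem IsLinear.isIso {A B : DSet.{u}} (hB : B.IsLinear) (f : A ⟶ B)
    [IsIso (restriction.map f)] : IsIso f := by
  rw [NatTrans.isIso_iff_isIso_app]
  intro R
  by_cases hR : R.unop.operad.IsUnary
  · have e : R ≅ op (Tree.inclusion.obj (SimplexCategory.mk (R.unop.numEdges - 1))) :=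
      (Tree.isoLinear hR).symm.op
    have : IsIso (f.app (op (Tree.inclusion.obj (SimplexCategory.mk (R.unop.numEdges - 1))))) :=
      inferInstanceAs (IsIso ((restriction.map f).app (op (SimplexCategory.mk _))))
    have h : f.app R = A.map e.hom ≫ f.app _ ≫ B.map e.inv := by
      rw [← f.naturality, ← A.map_comp_assoc]
      simp
    rw [h]
    infer_instance
  · rw [ConcreteCategory.isIso_iff_bijective]
    exact ⟨fun a => (hR (hB (f.app R a))).elim, fun b => (hR (hB b)).elim⟩

/-! ### The tensor product of linear dendroidal sets -/

theorem IsLinear.tensorObj {A B : DSet.{u}} (hA : A.IsLinear) (hB : B.IsLinear) :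
    (tensorObj A B).IsLinear := by
  rintro R ⟨t⟩
  exact (BV.tensor_isUnary (hA t.x) (hB t.y)).of_map t.z

/-- A dendrex of shape `R` of `N_d(Ω(S) ⊗ Ω(T))`, for unary `T`, followed by the projection to
`Ω(S)`. -/
noncomputable def fstComp {R S T : Tree} (hT : T.operad.IsUnary)
    (z : R.operad.Map (BV.tensor S.operad T.operad)) : R ⟶ S :=
  z.comp (BV.fst S.operad_isThin hT)

/-- A dendrex of shape `R` of `N_d(Ω(S) ⊗ Ω(T))`, for unary `S`, followed by the projection to
`Ω(T)`. -/
noncomputable def sndComp {R S T : Tree} (hS : S.operad.IsUnary)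
    (z : R.operad.Map (BV.tensor S.operad T.operad)) : R ⟶ T :=
  z.comp (BV.snd hS T.operad_isThin)

/-- The projection `A ⊗ B ⟶ A`, for linear `B`. -/
noncomputable def fst {A B : DSet.{u}} (hB : B.IsLinear) : tensorObj A B ⟶ A where
  app R := ↾Quot.lift (fun t => A.map (fstComp (hB t.y) t.z).op t.x) (by
    rintro _ _ ⟨α, β, x, y, z⟩
    dsimp only
    rw [← Functor.map_comp_apply, ← op_comp]
    exact congrArg (fun ρ => A.map (Quiver.Hom.op ρ) x) (Tree.hom_ext rfl))
  naturality R R' ρ := by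
    ext ⟨t⟩
    exact A.map_comp_apply (fstComp (hB t.y) t.z).op ρ t.x

/-- The projection `A ⊗ B ⟶ B`, for linear `A`. -/
noncomputable def snd {A B : DSet.{u}} (hA : A.IsLinear) : tensorObj A B ⟶ B where
  app R := ↾Quot.lift (fun t => B.map (sndComp (hA t.x) t.z).op t.y) (by
    rintro _ _ ⟨α, β, x, y, z⟩
    dsimp only
    rw [← Functor.map_comp_apply, ← op_comp]
    exact congrArg (fun ρ => B.map (Quiver.Hom.op ρ) y) (Tree.hom_ext rfl))
  naturality R R' ρ := by
    ext ⟨t⟩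
    exact B.map_comp_apply (sndComp (hA t.x) t.z).op ρ t.y

/-- The dendrex of shape `i([n])` of `N_d(Ω(i[n]) ⊗ Ω(i[n]))` given by the diagonal. -/
noncomputable abbrev diag (n : SimplexCategory) :
    (bv.obj (Tree.inclusion.obj n, Tree.inclusion.obj n)).obj (op (Tree.inclusion.obj n)) :=
  BV.diag (P := (Tree.linear n.len).operad) (Tree.linear_isUnary n.len) (Tree.operad_isThin _)

/-- For unary `S` and `T`, a dendrex of `N_d(Ω(S) ⊗ Ω(T))` is determined by its effect on colours,
since `Ω(S) ⊗ Ω(T)` is thin. -/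
theorem bv_ext {R S T : Tree} (hS : S.operad.IsUnary) (hT : T.operad.IsUnary)
    {z z' : R.operad.Map (BV.tensor S.operad T.operad)} (h : z.colour = z'.colour) : z = z' :=
  (BV.tensor_isThin hS S.operad_isThin hT T.operad_isThin).map_ext h

/-- The class of `(x, y, z)`, where `z` has shape `i([n])`, is the class of a diagonal triple: `z` is the diagonal followed
by the tensor product of its two projections, which can be moved to `x` and `y`. -/
theorem mk_eq_mk_diag {A B : DSet.{u}} {S T : Tree} (hS : S.operad.IsUnary)
    (hT : T.operad.IsUnary) (n : SimplexCategory) (x : A.obj (op S)) (y : B.obj (op T))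
    (z : (bv.obj (S, T)).obj (op (Tree.inclusion.obj n))) :
    Quot.mk (TensorRel A B _) ⟨S, T, x, y, z⟩ =
      Quot.mk (TensorRel A B _) ⟨Tree.inclusion.obj n, Tree.inclusion.obj n,
        A.map (fstComp hT z).op x, B.map (sndComp hS z).op y, diag n⟩ := by
  have h := Quot.sound (TensorRel.mk (fstComp hT z) (sndComp hS z) x y (diag n))
  refine Eq.trans ?_ h.symm
  congr 2
  exact bv_ext hS hT rfl

/-- The map `i^* A × i^* B ⟶ i^*(A ⊗ B)` that sends a pair of `n`-simplices to their tensor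
product, restricted along the diagonal of `Ω(i[n])`. -/
noncomputable def diagonalPair (A B : DSet.{u}) :
    restriction.obj A ⊗ restriction.obj B ⟶ restriction.obj (tensorObj A B) where
  app n := ↾fun p => Quot.mk _ ⟨_, _, p.1, p.2, diag n.unop⟩
  naturality n m f := by
    ext ⟨x, y⟩
    refine (Quot.sound (TensorRel.mk (Tree.inclusion.map f.unop) (Tree.inclusion.map f.unop)
      x y (diag m.unop))).trans ?_
    refine congrArg (fun z => Quot.mk _ (PreTensor.mk _ _ x y z)) ?_
    exact bv_ext (Tree.linear_isUnary _) (Tree.linear_isUnary _) rfl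

theorem diagonalPair_naturality {A A' B B' : DSet.{u}} (f : A ⟶ A') (g : B ⟶ B') :
    (restriction.map f ⊗ₘ restriction.map g) ≫ diagonalPair A' B' =
      diagonalPair A B ≫ restriction.map (tensorMap f g) := rfl

/-- The inverse is given by the two projections of `A ⊗ B`. -/
theorem isIso_diagonalPair {A B : DSet.{u}} (hA : A.IsLinear) (hB : B.IsLinear) :
    IsIso (diagonalPair A B) := by
  rw [NatTrans.isIso_iff_isIso_app]
  intro n
  rw [ConcreteCategory.isIso_iff_bijective]
  constructor
  · intro p q h
    have h₁ : ∀ p, (fst hB).app _ ((diagonalPair A B).app n p) = p.1 := fun p => by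
      have h : fstComp (hB p.2) (diag n.unop) = 𝟙 _ := Tree.hom_ext rfl
      exact (congrArg (fun ρ => A.map (Quiver.Hom.op ρ) p.1) h).trans (A.map_id_apply _ p.1)
    have h₂ : ∀ p, (snd hA).app _ ((diagonalPair A B).app n p) = p.2 := fun p => by
      have h : sndComp (hA p.1) (diag n.unop) = 𝟙 _ := Tree.hom_ext rfl
      exact (congrArg (fun ρ => B.map (Quiver.Hom.op ρ) p.2) h).trans (B.map_id_apply _ p.2)
    exact Prod.ext (by rw [← h₁ p, ← h₁ q, h]) (by rw [← h₂ p, ← h₂ q, h])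
  · rintro ⟨⟨S, T, x, y, z⟩⟩
    exact ⟨(_, _), (mk_eq_mk_diag (hA x) (hB y) n.unop x y z).symm⟩

/-! ### The left Kan extension -/

/-- The adjunction between `i_!` and `i^*`. -/
noncomputable def adjunction : extension.{u} ⊣ restriction.{u} :=
  Tree.inclusion.op.lanAdjunction (Type u)

instance : IsIso adjunction.{u}.unit :=
  inferInstanceAs (IsIso (Tree.inclusion.op.lanAdjunction (Type u)).unit)

/-- The unit `X ⟶ i^* i_! X` takes its values in the linear part of `i_! X`, a subobject, so that
the universal property gives a map from `i_! X` to its linear part. -/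
theorem extension_isLinear (X : SSet.{u}) : (extension.obj X).IsLinear := by
  let Z : Subfunctor (extension.obj X) :=
    { obj := fun R => {_z | R.unop.operad.IsUnary}
      map := fun {R R'} ρ z hz => hz.of_map ρ.unop }
  let r : extension.obj X ⟶ Z.toFunctor := (adjunction.homEquiv X _).symm
    { app := fun n => ↾fun x => ⟨(adjunction.unit.app X).app n x, Tree.linear_isUnary _⟩
      naturality := fun n m f => by
        ext x
        refine Subtype.ext ?_
        exact NatTrans.naturality_apply (adjunction.unit.app X) f x }
  exact fun R z => (r.app R z).2

/-- The map `i_!(X × Y) ⟶ i_! X ⊗ i_! Y` whose transpose sends a pair of simplices to its diagonal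
tensor product. -/
noncomputable def comparison (X Y : SSet.{u}) :
    extension.obj (X ⊗ Y) ⟶ tensorObj (extension.obj X) (extension.obj Y) :=
  (adjunction.homEquiv _ _).symm
    ((adjunction.unit.app X ⊗ₘ adjunction.unit.app Y) ≫ diagonalPair _ _)

theorem comparison_naturality {X X' Y Y' : SSet.{u}} (f : X ⟶ X') (g : Y ⟶ Y') :
    extension.map (f ⊗ₘ g) ≫ comparison X' Y' =
      comparison X Y ≫ tensorMap (extension.map f) (extension.map g) := by
  unfold comparison
  rw [← Adjunction.homEquiv_naturality_left_symm, ← Adjunction.homEquiv_naturality_right_symm,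
    Category.assoc, ← diagonalPair_naturality, tensorHom_comp_tensorHom_assoc,
    tensorHom_comp_tensorHom_assoc]
  exact congrArg (fun h => (adjunction.homEquiv _ _).symm (h ≫ diagonalPair _ _))
    (congrArg₂ (· ⊗ₘ ·) (adjunction.unit.naturality f) (adjunction.unit.naturality g))

instance (X Y : SSet.{u}) : IsIso (comparison X Y) := by
  have hX := extension_isLinear X
  have hY := extension_isLinear Y
  have := isIso_diagonalPair hX hY
  have h : adjunction.unit.app (X ⊗ Y) ≫ restriction.map (comparison X Y) =
      (adjunction.unit.app X ⊗ₘ adjunction.unit.app Y) ≫ diagonalPair _ _ :=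
    (adjunction.homEquiv_unit _ _ _).symm.trans (Equiv.apply_symm_apply _ _)
  have : IsIso (restriction.map (comparison X Y)) := by
    have : IsIso (adjunction.unit.app (X ⊗ Y) ≫ restriction.map (comparison X Y)) := by
      rw [h]
      infer_instance
    exact IsIso.of_isIso_comp_left (adjunction.unit.app (X ⊗ Y)) _
  exact (hX.tensorObj hY).isIso _

/-- The isomorphism `i_!(X × Y) ≅ i_! X ⊗ i_! Y`, natural in `X` and `Y`. -/
noncomputable def extensionTensorIso :
    curriedTensor SSet.{u} ⋙ (Functor.whiskeringRight _ _ _).obj extension.{u} ≅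
      extension.{u} ⋙ tensor.{u} ⋙ (Functor.whiskeringLeft _ _ _).obj extension.{u} :=
  NatIso.ofComponents
    (fun X => NatIso.ofComponents (fun Y => (asIso (comparison X Y) :)) fun {Y Y'} g => by
      have h := comparison_naturality (𝟙 X) g
      rw [id_tensorHom, extension.map_id] at h
      exact h)
    fun {X X'} f => by
      ext Y : 2
      have h := comparison_naturality f (𝟙 Y)
      rw [tensorHom_id, extension.map_id] at h
      exact h

/-! ### The internal Hom out of a left Kan extension -/

/-- The isomorphism `Ω[n] ≅ i_! Δ[n]`, natural in `n`. -/
noncomputable def representableIso :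
    Tree.inclusion ⋙ representable.{u} ≅ SSet.stdSimplex.{u} ⋙ extension.{u} :=
  Presheaf.compULiftYonedaIsoULiftYonedaCompLan.{u} Tree.inclusion

/-- The isomorphism `i_!(Δ[n] × X) ≅ Ω[n] ⊗ i_! X`. -/
noncomputable def extensionStdSimplexIso (n : SimplexCategory) (X : SSet.{u}) :
    extension.obj (SSet.stdSimplex.obj n ⊗ X) ≅
      (tensor.obj (representable.obj (Tree.inclusion.obj n))).obj (extension.obj X) :=
  (asIso (comparison (SSet.stdSimplex.obj n) X) :) ≪≫
    (tensor.mapIso (representableIso.symm.app n)).app (extension.obj X)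

theorem extensionStdSimplexIso_hom_naturality_left {n m : SimplexCategory} (f : n ⟶ m)
    (X : SSet.{u}) :
    extension.map (SSet.stdSimplex.map f ▷ X) ≫ (extensionStdSimplexIso m X).hom =
      (extensionStdSimplexIso n X).hom ≫
        (tensor.map (representable.map (Tree.inclusion.map f))).app (extension.obj X) := by
  have h₁ : extension.map (SSet.stdSimplex.map f ▷ X) ≫ comparison (SSet.stdSimplex.obj m) X =
      comparison (SSet.stdSimplex.obj n) X ≫
        (tensor.map (extension.map (SSet.stdSimplex.map f))).app (extension.obj X) := by
    have h := comparison_naturality (SSet.stdSimplex.map f) (𝟙 X)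
    rw [tensorHom_id, extension.map_id] at h
    exact h
  have h₂ : (tensor.map (extension.map (SSet.stdSimplex.map f))).app (extension.obj X) ≫
      (tensor.map (representableIso.inv.app m)).app (extension.obj X) =
      (tensor.map (representableIso.inv.app n)).app (extension.obj X) ≫
        (tensor.map (representable.map (Tree.inclusion.map f))).app (extension.obj X) := by
    rw [← NatTrans.comp_app, ← NatTrans.comp_app, ← tensor.map_comp, ← tensor.map_comp]
    exact congrArg (fun g => (tensor.map g).app (extension.obj X))
      (representableIso.inv.naturality f)
  change _ ≫ comparison _ X ≫ _ = (comparison _ X ≫ _) ≫ _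
  rw [reassoc_of% h₁, Category.assoc]
  exact congrArg (comparison (SSet.stdSimplex.obj n) X ≫ ·) h₂

theorem extensionStdSimplexIso_hom_naturality_right (n : SimplexCategory) {X Y : SSet.{u}}
    (f : X ⟶ Y) :
    extension.map (SSet.stdSimplex.obj n ◁ f) ≫ (extensionStdSimplexIso n Y).hom =
      (extensionStdSimplexIso n X).hom ≫
        (tensor.obj (representable.obj (Tree.inclusion.obj n))).map (extension.map f) := by
  have h₁ : extension.map (SSet.stdSimplex.obj n ◁ f) ≫ comparison (SSet.stdSimplex.obj n) Y =
      comparison (SSet.stdSimplex.obj n) X ≫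
        (tensor.obj (extension.obj (SSet.stdSimplex.obj n))).map (extension.map f) := by
    have h := comparison_naturality (𝟙 (SSet.stdSimplex.obj n)) f
    rw [id_tensorHom, extension.map_id] at h
    exact h
  change _ ≫ comparison _ Y ≫ _ = (comparison _ X ≫ _) ≫ _
  rw [reassoc_of% h₁, Category.assoc]
  exact congrArg (comparison (SSet.stdSimplex.obj n) X ≫ ·)
    ((tensor.map (representableIso.inv.app n)).naturality (extension.map f))

/-- The maps `Ω[n] ⊗ i_! X ⟶ D` are the maps `X × Δ[n] ⟶ i^* D`. -/
noncomputable def homEquivRestriction (n : SimplexCategory) (X : SSet.{u}) (D : DSet.{u}) :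
    ((tensor.obj (representable.obj (Tree.inclusion.obj n))).obj (extension.obj X) ⟶ D) ≃
      (X ⊗ SSet.stdSimplex.obj n ⟶ restriction.obj D) :=
  (extensionStdSimplexIso n X).symm.homFromEquiv.trans
    ((adjunction.homEquiv _ _).trans (β_ _ _).homFromEquiv)

theorem homEquivRestriction_apply (n : SimplexCategory) (X : SSet.{u}) (D : DSet.{u})
    (φ : (tensor.obj (representable.obj (Tree.inclusion.obj n))).obj (extension.obj X) ⟶ D) :
    homEquivRestriction n X D φ = (β_ X (SSet.stdSimplex.obj n)).hom ≫
      adjunction.homEquiv _ _ ((extensionStdSimplexIso n X).hom ≫ φ) := rfl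

/-- The `n`-simplices of `i^* Hom(i_! X, D)` are those of `(i^* D)^X`. -/
noncomputable def internalHomEquiv (n : SimplexCategory) (X : SSet.{u}) (D : DSet.{u}) :
    ((tensor.obj (representable.obj (Tree.inclusion.obj n))).obj (extension.obj X) ⟶ D) ≃
      ((ihom X).obj (restriction.obj D)).obj (op n) :=
  (homEquivRestriction n X D).trans
    (((ihom.adjunction X).homEquiv _ _).trans SSet.yonedaEquiv)

theorem internalHomEquiv_apply (n : SimplexCategory) (X : SSet.{u}) (D : DSet.{u})
    (φ : (tensor.obj (representable.obj (Tree.inclusion.obj n))).obj (extension.obj X) ⟶ D) :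
    internalHomEquiv n X D φ =
      SSet.yonedaEquiv (MonoidalClosed.curry (homEquivRestriction n X D φ)) := rfl

theorem internalHomEquiv_naturality_simplex {n m : SimplexCategory} (f : n ⟶ m) (X : SSet.{u})
    (D : DSet.{u})
    (φ : (tensor.obj (representable.obj (Tree.inclusion.obj m))).obj (extension.obj X) ⟶ D) :
    internalHomEquiv n X D
        ((tensor.map (representable.map (Tree.inclusion.map f))).app (extension.obj X) ≫ φ) =
      ((ihom X).obj (restriction.obj D)).map f.op (internalHomEquiv m X D φ) := by
  have h : homEquivRestriction n X D
      ((tensor.map (representable.map (Tree.inclusion.map f))).app (extension.obj X) ≫ φ) =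
      X ◁ SSet.stdSimplex.map f ≫ homEquivRestriction m X D φ := by
    rw [homEquivRestriction_apply, homEquivRestriction_apply,
      BraidedCategory.braiding_naturality_right_assoc,
      ← reassoc_of% extensionStdSimplexIso_hom_naturality_left, Adjunction.homEquiv_naturality_left]
  rw [internalHomEquiv_apply, internalHomEquiv_apply, h, MonoidalClosed.curry_natural_left]
  exact (uliftYonedaEquiv_naturality (X := op m) (Y := op n) _ f.op).symm

theorem internalHomEquiv_naturality_right (n : SimplexCategory) (X : SSet.{u}) {D D' : DSet.{u}}
    (g : D ⟶ D')
    (φ : (tensor.obj (representable.obj (Tree.inclusion.obj n))).obj (extension.obj X) ⟶ D) :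
    internalHomEquiv n X D' (φ ≫ g) =
      ((ihom X).map (restriction.map g)).app (op n) (internalHomEquiv n X D φ) := by
  have h : homEquivRestriction n X D' (φ ≫ g) =
      homEquivRestriction n X D φ ≫ restriction.map g := by
    rw [homEquivRestriction_apply, homEquivRestriction_apply, Category.assoc,
      ← Adjunction.homEquiv_naturality_right, Category.assoc]
  rw [internalHomEquiv_apply, internalHomEquiv_apply, h, MonoidalClosed.curry_natural_right]
  exact uliftYonedaEquiv_comp _ _

theorem internalHomEquiv_naturality_left (n : SimplexCategory) {X Y : SSet.{u}} (f : X ⟶ Y)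
    (D : DSet.{u})
    (φ : (tensor.obj (representable.obj (Tree.inclusion.obj n))).obj (extension.obj Y) ⟶ D) :
    internalHomEquiv n X D ((tensor.obj (representable.obj (Tree.inclusion.obj n))).map
        (extension.map f) ≫ φ) =
      ((MonoidalClosed.pre f).app (restriction.obj D)).app (op n) (internalHomEquiv n Y D φ) := by
  have h : homEquivRestriction n X D ((tensor.obj
      (representable.obj (Tree.inclusion.obj n))).map (extension.map f) ≫ φ) =
      f ▷ SSet.stdSimplex.obj n ≫ homEquivRestriction n Y D φ := by
    rw [homEquivRestriction_apply, homEquivRestriction_apply,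
      BraidedCategory.braiding_naturality_left_assoc,
      ← reassoc_of% extensionStdSimplexIso_hom_naturality_right,
      Adjunction.homEquiv_naturality_left]
  rw [internalHomEquiv_apply, internalHomEquiv_apply, h, ← MonoidalClosed.curry_pre_app]
  exact uliftYonedaEquiv_comp _ _

/-- The isomorphism `i^* Hom(i_! X, D) ≅ (i^* D)^X`, natural in `X` and `D`. -/
noncomputable def restrictionInternalHomIso :
    extension.{u}.op ⋙ internalHom.{u} ⋙ (Functor.whiskeringRight _ _ _).obj restriction.{u} ≅
      MonoidalClosed.internalHom (C := SSet.{u}) ⋙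
        (Functor.whiskeringLeft _ _ _).obj restriction.{u} :=
  NatIso.ofComponents
    (fun X => NatIso.ofComponents
      (fun D => NatIso.ofComponents (fun n => (internalHomEquiv n.unop X.unop D).toIso)
        fun {n m} f => by
          ext φ
          exact internalHomEquiv_naturality_simplex f.unop X.unop D φ)
      fun {D D'} g => by
        ext n φ
        exact internalHomEquiv_naturality_right n.unop X.unop g φ)
    fun {X Y} f => by
      ext D n φ
      exact internalHomEquiv_naturality_left n.unop f.unop D φ

/-- The isomorphism `i^* Hom(i_! X, i_! Y) ≅ Y^X`, natural in `X` and `Y`. -/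
noncomputable def restrictionInternalHomExtensionIso :
    extension.{u}.op ⋙ internalHom.{u} ⋙ (Functor.whiskeringLeft _ _ _).obj extension.{u} ⋙
        (Functor.whiskeringRight _ _ _).obj restriction.{u} ≅
      MonoidalClosed.internalHom (C := SSet.{u}) :=
  Functor.isoWhiskerRight restrictionInternalHomIso
      ((Functor.whiskeringLeft _ _ _).obj extension.{u}) ≪≫
    Functor.isoWhiskerLeft MonoidalClosed.internalHom
      ((Functor.whiskeringLeft _ _ _).mapIso (asIso adjunction.{u}.unit).symm)

end DSet

end Dendroidal

/-- For simplicial sets `X`, `Y` and a dendroidal set `D` there are isomorphisms, natural in all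
variables, `i_!(X × Y) ≅ i_! X ⊗ i_! Y`, `i^* Hom(i_! X, D) ≅ (i^* D)^X` and
`i^* Hom(i_! X, i_! Y) ≅ Y^X`. -/
theorem proposition5p3 :
    -- `(X, Y) ↦ i_!(X × Y)` and `(X, Y) ↦ i_! X ⊗ i_! Y`
    Nonempty
      (curriedTensor SSet.{u} ⋙ (Functor.whiskeringRight _ _ _).obj DSet.extension.{u} ≅
        DSet.extension.{u} ⋙ DSet.tensor.{u} ⋙
          (Functor.whiskeringLeft _ _ _).obj DSet.extension.{u}) ∧
    -- `(X, D) ↦ i^* Hom(i_! X, D)` and `(X, D) ↦ (i^* D)^X`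
    Nonempty
      (DSet.extension.{u}.op ⋙ DSet.internalHom.{u} ⋙
          (Functor.whiskeringRight _ _ _).obj DSet.restriction.{u} ≅
        MonoidalClosed.internalHom (C := SSet.{u}) ⋙
          (Functor.whiskeringLeft _ _ _).obj DSet.restriction.{u}) ∧
    -- `(X, Y) ↦ i^* Hom(i_! X, i_! Y)` and `(X, Y) ↦ Y^X`
    Nonempty
      (DSet.extension.{u}.op ⋙ DSet.internalHom.{u} ⋙
          (Functor.whiskeringLeft _ _ _).obj DSet.extension.{u} ⋙
            (Functor.whiskeringRight _ _ _).obj DSet.restriction.{u} ≅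
        MonoidalClosed.internalHom (C := SSet.{u})) :=
  ⟨⟨DSet.extensionTensorIso⟩, ⟨DSet.restrictionInternalHomIso⟩,
    ⟨DSet.restrictionInternalHomExtensionIso⟩⟩
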